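/- Let $\mathcal P$ be a countable set with a map $N:\mathcal P\to\mathbb Z_{>1}$, let $\mathcal M$ be the free abelian monoid generated by $\mathcal P$, whose elements are written $\mathfrak m=\sum_{\mathfrak p\in\mathcal P} n_{\mathfrak p}(\mathfrak m)\,\mathfrak p$ with integers $n_{\mathfrak p}(\mathfrak m)\ge 0$, almost all zero, and extend $N$ to $\mathcal M$ by $N(\mathfrak m)=\prod_{\mathfrak p}N(\mathfrak p)^{n_{\mathfrak p}(\mathfrak m)}$. Let $X\subseteq\mathbb Q$ contain $N(\mathfrak m)$ for every $\mathfrak m\in\mathcal M$ and satisfy $x_1/x_2\in X$ whenever $x_1,x_2\in X$ and $x_2\ne 0$ (for example $X=\mathbb Q$, or $X=\{q^z: z\in\mathbb Z\}$ for an integer $q\ge 2$ when all norms are powers of $q$). Assume that there are $\kappa>0$ and $0\le\theta<1$ such that, for $x\in X$ sufficiently large, the set of $\mathfrak m\in\mathcal M$ with $N(\mathfrak m)\le x$ is finite and $$\big|\{\mathfrak m\in\mathcal M: N(\mathfrak m)\le x\}\big|=\kappa x+O(x^\theta).$$ Let $h\ge 2$ be an integer. Let $\mathcal S_h(x)$ be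 the set of $h$-free elements of norm at most $x$, that is, of $\mathfrak m\in\mathcal M$ with $N(\mathfrak m)\le x$ and $n_{\mathfrak p}(\mathfrak m)\le h-1$ for all $\mathfrak p\in\mathcal P$. Let $\omega_1(\mathfrak m)=|\{\mathfrak p\in\mathcal P: n_{\mathfrak p}(\mathfrak m)=1\}|$. Then for every $a\in\mathbb R$, $$\lim_{\substack{x\to\infty\\ x\in X}}\frac{1}{|\mathcal S_h(x)|}\left|\left\{\mathfrak m\in\mathcal S_h(x): N(\mathfrak m)\ge 3,\ \frac{\omega_1(\mathfrak m)-\log\log N(\mathfrak m)}{\sqrt{\log\log N(\mathfrak m)}}\le a\right\}\right|=\frac{1}{\sqrt{2\pi}}\int_{-\infty}^{a}e^{-u^2/2}\,du.$$ -/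

import Mathlib

open Filter Topology Asymptotics

namespace AbelianMonoid

/-- The free abelian monoid generated by `P`: an element `m` is the formal sum
`∑ p, m p • p`, with `m p = 0` for all but finitely many `p`. -/
abbrev FreeMon (P : Type*) : Type _ := P →₀ ℕ

variable {P : Type*}

/-- The extension `N(m) = ∏ p, N(p) ^ (m p)` of a norm map on the generators to the monoid. -/
def norm (N : P → ℕ) (m : FreeMon P) : ℕ := m.prod fun p k => N p ^ k

/-- `S(x)`: the elements of `S` of norm at most `x`. -/
def upTo (N : P → ℕ) (S : Set (FreeMon P)) (x : ℚ) : Set (FreeMon P) :=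
  {m | m ∈ S ∧ (norm N m : ℚ) ≤ x}

/-- The limit `x → ∞` with `x` restricted to `X`. -/
def toInftyIn (X : Set ℚ) : Filter ℚ := atTop ⊓ 𝓟 X

/-- The set `X` of admissible bounds: a set of rational numbers which contains the norm of every
element of the monoid and is closed under taking fractions.
(In particular `ℚ`, or the powers of `q` when all norms are powers of `q`.) -/
structure IsNormRange (N : P → ℕ) (X : Set ℚ) : Prop where
  norm_mem : ∀ m : FreeMon P, (norm N m : ℚ) ∈ X
  div_mem : ∀ x₁ ∈ X, ∀ x₂ ∈ X, x₂ ≠ 0 → x₁ / x₂ ∈ X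

/-- For `x ∈ X`, the number of elements of the monoid with norm at most `x` is (finite and)
`κ x + O(x ^ θ)`, for some `κ > 0` and `0 ≤ θ < 1`. -/
def SatisfiesStar (N : P → ℕ) (X : Set ℚ) : Prop :=
  (∀ᶠ x in toInftyIn X, (upTo N Set.univ x).Finite) ∧
  ∃ κ θ : ℝ, 0 < κ ∧ 0 ≤ θ ∧ θ < 1 ∧
    (fun x : ℚ => ((upTo N Set.univ x).ncard : ℝ) - κ * (x : ℝ))
      =O[toInftyIn X] fun x : ℚ => (x : ℝ) ^ θ

/-- The set of `h`-free elements: every generator that occurs has multiplicity at most `h - 1`. -/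
def hFree (P : Type*) (h : ℕ) : Set (FreeMon P) :=
  {m | ∀ p ∈ m.support, m p ≤ h - 1}

/-- `ω₁(m)`: the number of generators which occur in `m` with multiplicity exactly one. -/
def omegaOne (m : FreeMon P) : ℕ := (m.support.filter fun p => m p = 1).card

/-- The distribution function of the standard normal law. -/
noncomputable def gaussPhi (a : ℝ) : ℝ :=
  1 / Real.sqrt (2 * Real.pi) * ∫ u in Set.Iic a, Real.exp (-u ^ 2 / 2)

end AbelianMonoid

/-! ### Counting functions and an elementary sieve. -/

namespace AbelianMonoid

variable {P : Type*} {N : P → ℕ}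

/-! For a random `h`-free element of norm at most `x`, the events "`p` occurs exactly once" behave
like independent events of probability `freq N h p`, which is `1/N(p)` up to a summable error. So
`ω₁` resembles a Poisson variable whose parameter is the sum of `1/N(p)` over `N(p) ≤ x`. By a
Mertens theorem this parameter is `log log x + O(1)`, and a Poisson variable with large parameter is
nearly normal.

Three ingredients make this precise. The Mertens estimate (`Regular.exists_mertens`) follows from
the growth of the zeta function at `s = 1`, through partial Euler products and a quadratic Tauberian
sandwich. A sieve (`Regular.exists_cnt_hFreeExact`) counts the `h`-free elements in which every `p`
of a finite set `d` occurs exactly once, with error `O(x^θ 2^|d|)`. An inclusion-exclusion truncated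
at about `log log x` factors (`norm_sum_pow_sub_prod_le`) converts these counts into the
characteristic function of the number of simple generators.

The truncation is affordable only for generators of norm at most `cut x = x^(1/(log log x)^2)`. The
remaining generators contribute `O(log log log x)` on average, which is negligible against the
standard deviation `√(log log x)`. Lévy's continuity theorem then gives the limit law normalized by
`x`. It passes to the normalization by `N(m)` because almost all elements have norm above `√x`,
where `log log N(m)` and `log log x` differ by less than 1. -/

lemma norm_zero (N : P → ℕ) : norm N 0 = 1 := by simp [norm]

lemma norm_add (N : P → ℕ) (m n : FreeMon P) : norm N (m + n) = norm N m * norm N n :=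
  Finsupp.prod_add_index' (fun _ => pow_zero _) fun _ _ _ => pow_add _ _ _

lemma norm_single (N : P → ℕ) (p : P) (k : ℕ) : norm N (Finsupp.single p k) = N p ^ k :=
  Finsupp.prod_single_index (pow_zero _)

lemma norm_pos (hN : ∀ p, 1 < N p) (m : FreeMon P) : 0 < norm N m :=
  Finset.prod_pos fun p _ => pow_pos (zero_lt_one.trans (hN p)) _

lemma one_le_norm (hN : ∀ p, 1 < N p) (m : FreeMon P) : (1 : ℝ) ≤ norm N m := by
  exact_mod_cast norm_pos hN m

lemma single_le_norm (hN : ∀ p, 1 < N p) {m : FreeMon P} {p : P} {k : ℕ} (h : k ≤ m p) :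
    N p ^ k ≤ norm N m := by
  classical
  have h' : Finsupp.single p k ≤ m := by
    simpa using h
  rw [← tsub_add_cancel_of_le h', norm_add, norm_single]
  exact Nat.le_mul_of_pos_left _ (norm_pos hN _)

/-- Elements of `S` of norm at most the real number `x`. -/
def below (N : P → ℕ) (S : Set (FreeMon P)) (x : ℝ) : Set (FreeMon P) :=
  {m | m ∈ S ∧ (norm N m : ℝ) ≤ x}

/-- The number of elements of `S` of norm at most `x`. -/
noncomputable def cnt (N : P → ℕ) (S : Set (FreeMon P)) (x : ℝ) : ℝ := (below N S x).ncard

lemma upTo_eq_below (N : P → ℕ) (S : Set (FreeMon P)) (x : ℚ) : upTo N S x = below N S (x : ℝ) := by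
  ext m
  simp only [upTo, below, Set.mem_ofPred_eq, and_congr_right_iff]
  intro _
  exact_mod_cast (Rat.cast_le (K := ℝ) (p := (norm N m : ℚ)) (q := x)).symm

lemma below_mono {S T : Set (FreeMon P)} {x y : ℝ} (hST : S ⊆ T) (hxy : x ≤ y) :
    below N S x ⊆ below N T y := fun _ hm => ⟨hST hm.1, hm.2.trans hxy⟩

/-- The counting hypothesis with all constants made explicit, over a set `Y` of real numbers. -/
structure Regular (N : P → ℕ) (Y : Set ℝ) (κ θ C q : ℝ) : Prop where
  one_lt : ∀ p, 1 < N p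
  finite : ∀ x : ℝ, (below N Set.univ x).Finite
  div_mem : ∀ x ∈ Y, ∀ m : FreeMon P, x / norm N m ∈ Y
  κ_pos : 0 < κ
  -- Enlarging `θ` only weakens the bound for `x ≥ 1`. With `θ ≥ 3/4` and `h ≥ 2`, the sum of
  -- `N(p)^(-hθ)` converges because `hθ ≥ 3/2`.
  le_θ : 3 / 4 ≤ θ
  θ_lt : θ < 1
  C_nonneg : 0 ≤ C
  bound : ∀ x ∈ Y, 0 < x → |cnt N Set.univ x - κ * x| ≤ C * x ^ θ
  one_lt_q : 1 < q
  -- A geometric progression in `Y` lets monotonicity transfer estimates from `Y` to all real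
  -- numbers.
  pow_mem : ∀ k : ℕ, q ^ k ∈ Y

section Regular

variable {Y : Set ℝ} {κ θ C q : ℝ}

lemma Regular.finite_below (R : Regular N Y κ θ C q) (S : Set (FreeMon P)) (x : ℝ) :
    (below N S x).Finite := (R.finite x).subset (below_mono (Set.subset_univ _) le_rfl)

lemma Regular.cnt_mono (R : Regular N Y κ θ C q) {S T : Set (FreeMon P)} {x y : ℝ} (hST : S ⊆ T)
    (hxy : x ≤ y) : cnt N S x ≤ cnt N T y :=
  Nat.cast_le.2 (Set.ncard_le_ncard (below_mono hST hxy) (R.finite_below T y))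

lemma cnt_nonneg (N : P → ℕ) (S : Set (FreeMon P)) (x : ℝ) : 0 ≤ cnt N S x := Nat.cast_nonneg _

lemma Regular.one_le_cnt (R : Regular N Y κ θ C q) {x : ℝ} (hx : 1 ≤ x) :
    1 ≤ cnt N Set.univ x := by
  have : 0 < (below N Set.univ x).ncard := by
    rw [Set.ncard_pos (R.finite x)]
    exact ⟨0, trivial, by simpa [norm_zero] using hx⟩
  exact Nat.one_le_cast.2 this

lemma Regular.finite_primes (R : Regular N Y κ θ C q) (x : ℝ) : {p | (N p : ℝ) ≤ x}.Finite := by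
  refine Set.Finite.of_injOn (f := fun p => Finsupp.single p 1) (t := below N Set.univ x) ?_ ?_
    (R.finite x)
  · intro p hp
    exact ⟨trivial, by simpa [norm_single] using hp⟩
  · intro p _ p' _ h
    exact Finsupp.single_left_injective one_ne_zero h

lemma Regular.q_pos (R : Regular N Y κ θ C q) : 0 < q := zero_lt_one.trans R.one_lt_q

/-- The counting hypothesis speaks only of `Y`. Rounding `x` up to the next power of `q` loses at
most a factor `q`, and below 1 there is nothing to count. -/
lemma Regular.exists_cnt_le (R : Regular N Y κ θ C q) :
    ∃ K, 0 < K ∧ ∀ x, 0 < x → cnt N Set.univ x ≤ K * x := by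
  have hq := R.q_pos
  have hq1 := R.one_lt_q
  refine ⟨(κ + C) * q, mul_pos (by linarith [R.κ_pos, R.C_nonneg]) hq, fun x hx => ?_⟩
  have hκC : 0 < κ + C := by linarith [R.κ_pos, R.C_nonneg]
  rcases lt_or_ge x 1 with h1 | h1
  · have : below N Set.univ x = ∅ := by
      ext m
      simp only [below, Set.mem_ofPred_eq, Set.mem_empty_iff_false, iff_false, not_and, not_le]
      exact fun _ => h1.trans_le (one_le_norm R.one_lt m)
    simp only [cnt, this, Set.ncard_empty, Nat.cast_zero]
    positivity
  · obtain ⟨n, hn, hn'⟩ := exists_nat_pow_near h1 R.one_lt_q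
    have hpos : 0 < q ^ (n + 1) := by positivity
    have h1q : 1 ≤ q ^ (n + 1) := one_le_pow₀ R.one_lt_q.le
    have hb := (abs_le.1 (R.bound _ (R.pow_mem (n + 1)) hpos)).2
    have hle : (q ^ (n + 1)) ^ θ ≤ q ^ (n + 1) := by
      simpa using Real.rpow_le_rpow_of_exponent_le h1q R.θ_lt.le
    have := mul_le_mul_of_nonneg_left hle R.C_nonneg
    calc cnt N Set.univ x ≤ cnt N Set.univ (q ^ (n + 1)) := R.cnt_mono le_rfl hn'.le
      _ ≤ (κ + C) * q ^ (n + 1) := by linarith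
      _ = (κ + C) * q * q ^ n := by ring
      _ ≤ _ := by gcongr

/-- The main term dominates any term of smaller order. -/
lemma eventually_mul_rpow_le {a b θ : ℝ} (ha : 0 < a) (hθ : θ < 1) :
    ∀ᶠ x : ℝ in atTop, b * x ^ θ ≤ a * x := by
  have h : Tendsto (fun x : ℝ => b * x ^ (-(1 - θ))) atTop (𝓝 (b * 0)) :=
    (tendsto_rpow_neg_atTop (by linarith)).const_mul b
  rw [mul_zero] at h
  filter_upwards [h.eventually (gt_mem_nhds ha), eventually_gt_atTop 0] with x hx hx0
  have : x ^ θ = x ^ (-(1 - θ)) * x := by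
    rw [← Real.rpow_add_one hx0.ne']; congr 1; ring
  rw [this, ← mul_assoc]
  exact mul_le_mul_of_nonneg_right hx.le hx0.le

/-- Round down to a power of `q` at which the error is at most half the main term. For the bounded
range of `x` where this is not available, the zero element alone suffices. -/
lemma Regular.exists_le_cnt (R : Regular N Y κ θ C q) :
    ∃ c, 0 < c ∧ ∀ x, 1 ≤ x → c * x ≤ cnt N Set.univ x := by
  have hq := R.q_pos
  have hq1 := R.one_lt_q
  have hκ := R.κ_pos
  obtain ⟨y₀, hy₀⟩ := eventually_atTop.1
    (eventually_mul_rpow_le (b := C) (half_pos R.κ_pos) R.θ_lt)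
  set y := max y₀ 1
  have hy : 0 < y := lt_max_of_lt_right one_pos
  refine ⟨min (κ / (2 * q)) (1 / (q * y)), by positivity, fun x hx => ?_⟩
  rcases le_total x (q * y) with h | h
  · refine le_trans ?_ (R.one_le_cnt hx)
    calc min (κ / (2 * q)) (1 / (q * y)) * x ≤ 1 / (q * y) * (q * y) := by
          gcongr; exact min_le_right _ _
      _ = 1 := by field_simp
  · obtain ⟨n, hn, hn'⟩ := exists_nat_pow_near hx R.one_lt_q
    have hpos : 0 < q ^ n := by positivity
    have hyn : y₀ ≤ q ^ n := by
      have : q * y < q * q ^ n := by rw [← pow_succ']; exact h.trans_lt hn'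
      exact (le_max_left _ _).trans (lt_of_mul_lt_mul_left this hq.le).le
    have hb := (abs_le.1 (R.bound _ (R.pow_mem n) hpos)).1
    have := hy₀ _ hyn
    calc min (κ / (2 * q)) (1 / (q * y)) * x ≤ κ / (2 * q) * q ^ (n + 1) := by
          gcongr; exact min_le_left _ _
      _ = κ / 2 * q ^ n := by rw [pow_succ]; field_simp
      _ ≤ cnt N Set.univ (q ^ n) := by linarith
      _ ≤ _ := R.cnt_mono le_rfl hn

/-- Elements whose multiplicity at each `p ∈ Q` is less than `k p`. -/
def sifted (Q : Finset P) (k : P → ℕ) : Set (FreeMon P) := {m | ∀ p ∈ Q, m p < k p}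

/-- The elements removed by the new condition are those containing `k p` copies of `p`. Deleting
these copies is a bijection onto the elements counted in the last term, since `p ∉ Q` leaves the
other conditions untouched. -/
lemma Regular.cnt_sifted_insert [DecidableEq P] (R : Regular N Y κ θ C q) {Q : Finset P} {p : P}
    (hp : p ∉ Q) (k : P → ℕ) (x : ℝ) :
    cnt N (sifted (insert p Q) k) x
      = cnt N (sifted Q k) x - cnt N (sifted Q k) (x / (N p ^ k p : ℕ)) := by
  have hNp : (0 : ℝ) < (N p ^ k p : ℕ) := by
    exact_mod_cast pow_pos (zero_lt_one.trans (R.one_lt p)) _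
  have himg : below N (sifted Q k) x \ below N (sifted (insert p Q) k) x
      = (fun m => m + Finsupp.single p (k p)) '' below N (sifted Q k) (x / (N p ^ k p : ℕ)) := by
    ext m
    simp only [below, sifted, Set.mem_sdiff, Set.mem_ofPred_eq, Finset.mem_insert, forall_eq_or_imp,
      Set.mem_image, not_and]
    constructor
    · rintro ⟨⟨h1, h2⟩, h3⟩
      have hk : k p ≤ m p := by
        by_contra hlt
        exact h3 ⟨not_le.1 hlt, h1⟩ h2
      have hle : Finsupp.single p (k p) ≤ m := by simpa using hk
      have hsub : m - Finsupp.single p (k p) + Finsupp.single p (k p) = m := tsub_add_cancel_of_le hle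
      refine ⟨m - Finsupp.single p (k p), ⟨fun p' hp' => ?_, ?_⟩, hsub⟩
      · exact lt_of_le_of_lt (by simp) (h1 p' hp')
      · rw [le_div_iff₀ hNp, ← norm_single, ← Nat.cast_mul, ← norm_add, hsub]
        exact h2
    · rintro ⟨n, ⟨h1, h2⟩, rfl⟩
      refine ⟨⟨fun p' hp' => ?_, ?_⟩, fun h => ?_⟩
      · have : p ≠ p' := fun e => hp (e ▸ hp')
        simpa [Finsupp.single_apply, this] using h1 p' hp'
      · rw [le_div_iff₀ hNp, ← norm_single, ← Nat.cast_mul, ← norm_add] at h2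
        exact h2
      · exact absurd h.1 (by simp)
  have hsub : below N (sifted (insert p Q) k) x ⊆ below N (sifted Q k) x :=
    below_mono (fun m hm p' hp' => hm p' (Finset.mem_insert_of_mem hp')) le_rfl
  have hc := Set.ncard_sdiff_add_ncard_of_subset hsub (R.finite_below _ x)
  rw [himg, Set.ncard_image_of_injective _ (add_left_injective _)] at hc
  simp only [cnt]
  rw [← hc]
  push_cast
  ring

/-- Each step of the recursion `Regular.cnt_sifted_insert` multiplies the main term by `1 -
N(p)^(-k)` and the error by at most `1 + N(p)^(-kθ)`. The error stays `O(x^θ)` as long as the sum of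
`N(p)^(-kθ)` is bounded, which is why the sieve serves for `h`-th powers. -/
lemma Regular.abs_cnt_sifted_sub_le (R : Regular N Y κ θ C q) (Q : Finset P) (k : P → ℕ) {x : ℝ}
    (hx : x ∈ Y) (hx0 : 0 < x) :
    |cnt N (sifted Q k) x - κ * x * ∏ p ∈ Q, (1 - (N p ^ k p : ℝ)⁻¹)|
      ≤ C * x ^ θ * ∏ p ∈ Q, (1 + (N p ^ k p : ℝ)⁻¹ ^ θ) := by
  classical
  induction Q using Finset.induction_on generalizing x with
  | empty =>
    have : sifted (∅ : Finset P) k = Set.univ := by ext; simp [sifted]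
    simpa [this] using R.bound x hx hx0
  | insert p Q hp ih =>
    have hNp : (0 : ℝ) < N p ^ k p := pow_pos (by exact_mod_cast zero_lt_one.trans (R.one_lt p)) _
    have hxp : x / (N p ^ k p : ℕ) ∈ Y := by
      rw [← norm_single]; exact R.div_mem x hx _
    have h1 := ih hx hx0
    have h2 := ih hxp (div_pos hx0 (by exact_mod_cast hNp))
    rw [R.cnt_sifted_insert hp, Finset.prod_insert hp, Finset.prod_insert hp]
    push_cast at h2 ⊢
    have h3 : (x / N p ^ k p) ^ θ = x ^ θ * (N p ^ k p : ℝ)⁻¹ ^ θ := by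
      rw [div_eq_mul_inv, Real.mul_rpow hx0.le (inv_nonneg.2 hNp.le)]
    rw [h3] at h2
    refine (le_of_eq ?_).trans ((abs_sub _ _).trans ((add_le_add h1 h2).trans (le_of_eq ?_)))
    · congr 1
      rw [div_eq_mul_inv]
      ring
    · ring

end Regular

end AbelianMonoid

/-! ### The zeta function near `s = 1` and its partial Euler products. -/

namespace AbelianMonoid

variable {P : Type*} {N : P → ℕ} {Y : Set ℝ} {κ θ C q : ℝ}

lemma lintegral_indicator_Ici_rpow {a c : ℝ} (ha : a < -1) (hc : 0 < c) :
    ∫⁻ u, (Set.Ici c).indicator (fun u : ℝ => ENNReal.ofReal (u ^ a)) u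
      = ENNReal.ofReal (-c ^ (a + 1) / (a + 1)) := by
  rw [MeasureTheory.lintegral_indicator measurableSet_Ici,
    MeasureTheory.Measure.restrict_congr_set MeasureTheory.Ioi_ae_eq_Ici.symm,
    ← integral_Ioi_rpow_of_lt ha hc,
    MeasureTheory.ofReal_integral_eq_lintegral_ofReal (integrableOn_Ioi_rpow_of_lt ha hc)]
  refine (MeasureTheory.ae_restrict_iff' measurableSet_Ioi).2 (Filter.Eventually.of_forall fun u hu => ?_)
  exact Real.rpow_nonneg (hc.trans hu).le _

/-- Partial summation: write `N(m)^(-s)` as the integral of `s u^(-s-1)` over `u ≥ N(m)` and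
exchange sum and integral. In `ENNReal` this needs no prior knowledge of convergence. -/
lemma Regular.tsum_norm_rpow_eq_lintegral [Countable P] (R : Regular N Y κ θ C q) {s : ℝ}
    (hs : 0 < s) :
    ∑' m : FreeMon P, ENNReal.ofReal ((norm N m : ℝ) ^ (-s))
      = ∫⁻ u, (Set.Ici 1).indicator
          (fun u : ℝ => ENNReal.ofReal (s * cnt N Set.univ u * u ^ (-s - 1))) u := by
  have h1 : ∀ m : FreeMon P, ENNReal.ofReal ((norm N m : ℝ) ^ (-s))
      = ∫⁻ u, (Set.Ici (norm N m : ℝ)).indicator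
          (fun u => ENNReal.ofReal s * ENNReal.ofReal (u ^ (-s - 1))) u := by
    intro m
    have hm : (0 : ℝ) < norm N m := by exact_mod_cast norm_pos R.one_lt m
    simp only [Set.indicator_const_mul]
    rw [MeasureTheory.lintegral_const_mul _ (Measurable.indicator (by fun_prop) measurableSet_Ici),
      lintegral_indicator_Ici_rpow (by linarith) hm, ← ENNReal.ofReal_mul hs.le]
    congr 1
    rw [sub_add_cancel]
    field_simp
  simp_rw [h1]
  rw [← MeasureTheory.lintegral_tsum
    (fun m => (Measurable.indicator (by fun_prop) measurableSet_Ici).aemeasurable)]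
  congr 1
  ext u
  have h2 : ∀ m : FreeMon P, (Set.Ici (norm N m : ℝ)).indicator
      (fun u => ENNReal.ofReal s * ENNReal.ofReal (u ^ (-s - 1))) u
      = (below N Set.univ u).indicator
        (fun _ => ENNReal.ofReal s * ENNReal.ofReal (u ^ (-s - 1))) m := by
    intro m
    simp [Set.indicator, below]
  simp_rw [h2]
  have hcard : ∑' m : FreeMon P, (below N Set.univ u).indicator
      (fun _ => ENNReal.ofReal s * ENNReal.ofReal (u ^ (-s - 1))) m
      = ((below N Set.univ u).ncard : ENNReal)
        * (ENNReal.ofReal s * ENNReal.ofReal (u ^ (-s - 1))) := by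
    generalize ENNReal.ofReal s * ENNReal.ofReal (u ^ (-s - 1)) = g
    rw [tsum_eq_sum (s := (R.finite u).toFinset)
      (fun m hm => Set.indicator_of_notMem (by simpa using hm) _),
      Finset.sum_congr rfl (g := fun _ => g)
      (fun m hm => Set.indicator_of_mem (by simpa using hm) _),
      Finset.sum_const, nsmul_eq_mul, Set.ncard_eq_toFinset_card _ (R.finite u)]
  rw [hcard]
  by_cases hu : u ∈ Set.Ici (1 : ℝ)
  · rw [Set.indicator_of_mem hu, ENNReal.ofReal_mul (mul_nonneg hs.le (cnt_nonneg _ _ _)), cnt,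
      ENNReal.ofReal_mul hs.le, ENNReal.ofReal_natCast]
    ring
  · rw [Set.indicator_of_notMem hu]
    have : below N Set.univ u = ∅ := by
      ext m
      simp only [below, Set.mem_ofPred_eq, Set.mem_empty_iff_false, iff_false, not_and, not_le]
      exact fun _ => (not_le.1 hu).trans_le (one_le_norm R.one_lt m)
    simp [this]

lemma lintegral_const_mul_rpow {b s : ℝ} (hb : 0 ≤ b) (hs : 1 < s) :
    ∫⁻ u, (Set.Ici 1).indicator (fun u : ℝ => ENNReal.ofReal (b * u ^ (-s))) u
      = ENNReal.ofReal (b / (s - 1)) := by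
  simp only [ENNReal.ofReal_mul hb, Set.indicator_const_mul]
  rw [MeasureTheory.lintegral_const_mul _ (Measurable.indicator (by fun_prop) measurableSet_Ici),
    lintegral_indicator_Ici_rpow (by linarith) one_pos, ← ENNReal.ofReal_mul hb]
  congr 1
  rw [Real.one_rpow, neg_div, ← div_neg, neg_add, neg_neg, ← sub_eq_add_neg]
  ring

/-- The zeta function of the monoid. -/
noncomputable def zeta (N : P → ℕ) (s : ℝ) : ℝ := ∑' m : FreeMon P, (norm N m : ℝ) ^ (-s)

/-- Only the order of magnitude `c u ≤ cnt ≤ K u` enters the integral. This determines `log ζ(s)` up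
to `O(1)`, which is all that the Mertens theorem requires. -/
lemma Regular.exists_zeta_bounds [Countable P] (R : Regular N Y κ θ C q) :
    ∃ c K, 0 < c ∧ 0 < K ∧ ∀ s, 1 < s → (Summable fun m : FreeMon P => (norm N m : ℝ) ^ (-s)) ∧
      c * s / (s - 1) ≤ zeta N s ∧ zeta N s ≤ K * s / (s - 1) := by
  obtain ⟨K, hK, hK'⟩ := R.exists_cnt_le
  obtain ⟨c, hc, hc'⟩ := R.exists_le_cnt
  refine ⟨c, K, hc, hK, fun s hs => ?_⟩
  have hs0 : 0 < s := by linarith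
  have hs1 : 0 < s - 1 := by linarith
  have hrp : ∀ u : ℝ, 1 ≤ u → u * u ^ (-s - 1) = u ^ (-s) := fun u hu => by
    rw [mul_comm, ← Real.rpow_add_one (by positivity), sub_add_cancel]
  have hup : ∑' m : FreeMon P, ENNReal.ofReal ((norm N m : ℝ) ^ (-s))
      ≤ ENNReal.ofReal (K * s / (s - 1)) := by
    rw [R.tsum_norm_rpow_eq_lintegral hs0, ← lintegral_const_mul_rpow (by positivity) hs]
    refine MeasureTheory.lintegral_mono fun u => Set.indicator_le_indicator' fun hu => ?_
    refine ENNReal.ofReal_le_ofReal ?_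
    have hu0 : (0 : ℝ) < u := one_pos.trans_le hu
    rw [← hrp u hu]
    calc s * cnt N Set.univ u * u ^ (-s - 1) ≤ s * (K * u) * u ^ (-s - 1) := by
          gcongr; exact hK' u hu0
      _ = _ := by ring
  have hlow : ENNReal.ofReal (c * s / (s - 1))
      ≤ ∑' m : FreeMon P, ENNReal.ofReal ((norm N m : ℝ) ^ (-s)) := by
    rw [R.tsum_norm_rpow_eq_lintegral hs0, ← lintegral_const_mul_rpow (by positivity) hs]
    refine MeasureTheory.lintegral_mono fun u => Set.indicator_le_indicator' fun hu => ?_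
    refine ENNReal.ofReal_le_ofReal ?_
    have hu0 : (0 : ℝ) < u := one_pos.trans_le hu
    rw [← hrp u hu]
    calc c * s * (u * u ^ (-s - 1)) = s * (c * u) * u ^ (-s - 1) := by ring
      _ ≤ _ := by gcongr; exact hc' u hu
  have hnn : ∀ m : FreeMon P, 0 ≤ (norm N m : ℝ) ^ (-s) := fun m =>
    Real.rpow_nonneg (Nat.cast_nonneg _) _
  have hsum : Summable fun m : FreeMon P => (norm N m : ℝ) ^ (-s) := by
    have := ENNReal.summable_toReal (ne_top_of_le_ne_top ENNReal.ofReal_ne_top hup)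
    simpa only [ENNReal.toReal_ofReal (hnn _)] using this
  rw [← ENNReal.ofReal_tsum_of_nonneg hnn hsum] at hup hlow
  exact ⟨hsum, (ENNReal.ofReal_le_ofReal_iff (tsum_nonneg hnn)).1 hlow,
    (ENNReal.ofReal_le_ofReal_iff (by positivity)).1 hup⟩

/-- A finite form of the Euler product: translation by `p` shows that removing the elements
divisible by `p` multiplies the sum by `1 - N(p)^(-s)`. -/
lemma tsum_sifted {s : ℝ}
    (hsum : Summable fun m : FreeMon P => (norm N m : ℝ) ^ (-s)) (Q : Finset P) :
    ∑' m, (sifted Q fun _ => 1).indicator (fun m : FreeMon P => (norm N m : ℝ) ^ (-s)) m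
      = (∏ p ∈ Q, (1 - (N p : ℝ) ^ (-s))) * zeta N s := by
  classical
  induction Q using Finset.induction_on with
  | empty =>
    have : sifted (∅ : Finset P) (fun _ => 1) = Set.univ := by ext; simp [sifted]
    simp [this, zeta]
  | insert p Q hp ih =>
    set F := fun m : FreeMon P => (norm N m : ℝ) ^ (-s)
    set U := sifted Q fun _ => 1
    set V := sifted (insert p Q) fun _ => 1
    have hVU : V ⊆ U := fun m hm p' hp' => hm p' (Finset.mem_insert_of_mem hp')
    have hdiff : ∑' m, (U \ V).indicator F m = (N p : ℝ) ^ (-s) * ∑' m, U.indicator F m := by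
      have hinj : Function.Injective fun m : FreeMon P => m + Finsupp.single p 1 :=
        add_left_injective _
      rw [← tsum_mul_left, ← hinj.tsum_eq]
      · refine tsum_congr fun m => ?_
        have hmem : m + Finsupp.single p 1 ∈ U \ V ↔ m ∈ U := by
          simp only [U, V, sifted, Set.mem_sdiff, Set.mem_ofPred_eq]
          constructor
          · exact fun h p' hp' => lt_of_le_of_lt (by simp) (h.1 p' hp')
          · refine fun h => ⟨fun p' hp' => ?_, fun h' => ?_⟩
            · have : p ≠ p' := fun e => hp (e ▸ hp')
              simpa [Finsupp.single_apply, this] using h p' hp'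
            · exact absurd (h' p (Finset.mem_insert_self _ _)) (by simp)
        have hF : F (m + Finsupp.single p 1) = (N p : ℝ) ^ (-s) * F m := by
          simp only [F, norm_add, norm_single, pow_one, Nat.cast_mul]
          rw [Real.mul_rpow (Nat.cast_nonneg _) (Nat.cast_nonneg _), mul_comm]
        by_cases hm : m ∈ U
        · rw [Set.indicator_of_mem (hmem.2 hm), Set.indicator_of_mem hm, hF]
        · rw [Set.indicator_of_notMem (mt hmem.1 hm), Set.indicator_of_notMem hm, mul_zero]
      · intro m hm
        have hm' : m ∈ U \ V := Set.mem_of_indicator_ne_zero hm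
        have hk : 1 ≤ m p := by
          by_contra hlt
          refine hm'.2 fun p' hp' => ?_
          rcases Finset.mem_insert.1 hp' with rfl | h
          · exact not_le.1 hlt
          · exact hm'.1 p' h
        exact ⟨m - Finsupp.single p 1, tsub_add_cancel_of_le (by simpa using hk)⟩
    have hsplit : ∑' m, U.indicator F m = ∑' m, V.indicator F m + ∑' m, (U \ V).indicator F m := by
      rw [← (hsum.indicator V).tsum_add (hsum.indicator (U \ V))]
      refine tsum_congr fun m => ?_
      by_cases hU : m ∈ U <;> by_cases hV : m ∈ V <;> simp [hU, hV]
      exact absurd (hVU hV) hU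
    rw [Finset.prod_insert hp, mul_assoc, ← ih]
    linarith

end AbelianMonoid

/-! ### The sum over generators and the Mertens theorem. -/

namespace AbelianMonoid

variable {P : Type*} {N : P → ℕ} {Y : Set ℝ} {κ θ C q : ℝ}

lemma exp_neg_le_one_sub {t : ℝ} (h0 : 0 ≤ t) (h1 : t ≤ 1 / 2) :
    Real.exp (-(t + 2 * t ^ 2)) ≤ 1 - t := by
  have hexp := Real.add_one_le_exp (t + 2 * t ^ 2)
  have hpos := Real.exp_pos (-(t + 2 * t ^ 2))
  have hmul : Real.exp (-(t + 2 * t ^ 2)) * Real.exp (t + 2 * t ^ 2) = 1 := by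
    rw [← Real.exp_add]; simp
  have h2 : 1 ≤ (1 - t) * Real.exp (t + 2 * t ^ 2) := by
    calc (1 : ℝ) ≤ (1 - t) * (t + 2 * t ^ 2 + 1) := by
          nlinarith [mul_nonneg (sq_nonneg t) (by linarith : 0 ≤ 1 - 2 * t)]
      _ ≤ _ := by gcongr; linarith
  have h3 := Real.exp_pos (t + 2 * t ^ 2)
  by_contra hlt
  nlinarith [not_le.1 hlt]

/-- A substitute for the convergence of the Euler product. Take a finite `T` carrying all but 1 of
the total, and sift by every generator occurring in `T`. What survives is the zero element, of
weight 1, and elements outside `T`. -/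
lemma exists_tsum_sifted_le {s : ℝ}
    (hsum : Summable fun m : FreeMon P => (norm N m : ℝ) ^ (-s)) :
    ∃ Q : Finset P,
      ∑' m, (sifted Q fun _ => 1).indicator (fun m : FreeMon P => (norm N m : ℝ) ^ (-s)) m ≤ 2 := by
  classical
  have h0 := hsum.hasSum.eventually (lt_mem_nhds (sub_one_lt _))
  obtain ⟨T, hT⟩ := h0.exists
  set F := fun m : FreeMon P => (norm N m : ℝ) ^ (-s)
  have hF : ∀ m, 0 ≤ F m := fun m => Real.rpow_nonneg (Nat.cast_nonneg _) _
  have hF0 : F 0 = 1 := by simp [F, norm_zero]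
  refine ⟨T.biUnion Finsupp.support, ?_⟩
  set U := sifted (T.biUnion Finsupp.support) fun _ => 1
  have hle : ∀ m, U.indicator F m
      ≤ F m - (T : Set (FreeMon P)).indicator F m + ({0} : Set (FreeMon P)).indicator F m := by
    intro m
    by_cases hm0 : m = 0
    · subst hm0
      have h1 := Set.indicator_le_self' (s := U) (f := F) (fun x _ => hF x) 0
      have h2 := Set.indicator_le_self' (s := (T : Set (FreeMon P))) (f := F) (fun x _ => hF x) 0
      simp only [Set.mem_singleton_iff, Set.indicator_of_mem]
      linarith
    · rw [Set.indicator_of_notMem (s := {0}) (by simpa using hm0), add_zero]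
      by_cases hmU : m ∈ U
      · have hmT : m ∉ T := by
          intro hmT
          refine hm0 (Finsupp.ext fun p => ?_)
          by_contra hp
          have : p ∈ m.support := Finsupp.mem_support_iff.2 hp
          exact hp (Nat.lt_one_iff.1 (hmU p (Finset.mem_biUnion.2 ⟨m, hmT, this⟩)))
        simp [hmU, hmT]
      · rw [Set.indicator_of_notMem hmU]
        exact sub_nonneg.2 (Set.indicator_le_self' (fun x _ => hF x) m)
  have hsT := hsum.indicator (T : Set (FreeMon P))
  have hs0 := hsum.indicator ({0} : Set (FreeMon P))
  have h3 := (hsum.indicator U).tsum_le_tsum hle ((hsum.sub hsT).add hs0)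
  rw [(hsum.sub hsT).tsum_add hs0, hsum.tsum_sub hsT, ← sum_eq_tsum_indicator] at h3
  have h4 : ∑' m, ({0} : Set (FreeMon P)).indicator F m = 1 := by
    rw [tsum_eq_single 0 (fun m hm => Set.indicator_of_notMem (by simpa using hm) _),
      Set.indicator_of_mem (Set.mem_singleton _), hF0]
  linarith

lemma rpow_neg_le_half {n : ℕ} (hn : 1 < n) {s : ℝ} (hs : 1 ≤ s) : (n : ℝ) ^ (-s) ≤ 1 / 2 := by
  have h2 : (2 : ℝ) ≤ n := by exact_mod_cast hn
  calc (n : ℝ) ^ (-s) ≤ (n : ℝ) ^ (-1 : ℝ) :=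
        Real.rpow_le_rpow_of_exponent_le (by linarith) (by linarith)
    _ = 1 / n := by rw [Real.rpow_neg_one, one_div]
    _ ≤ 1 / 2 := by gcongr

lemma summable_prime_rpow {s : ℝ} (hsum : Summable fun m : FreeMon P => (norm N m : ℝ) ^ (-s)) :
    Summable fun p => (N p : ℝ) ^ (-s) := by
  have := hsum.comp_injective (Finsupp.single_left_injective (α := P) (one_ne_zero : (1 : ℕ) ≠ 0))
  simpa [Function.comp_def, norm_single] using this

lemma Regular.summable_prime [Countable P] (R : Regular N Y κ θ C q) {s : ℝ} (hs : 1 < s) :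
    Summable fun p => (N p : ℝ) ^ (-s) := by
  obtain ⟨c, K, -, -, h⟩ := R.exists_zeta_bounds
  exact summable_prime_rpow (h s hs).1

/-- The sum `∑ N(p)^(-s)` grows like `log (1 / (s - 1))` as `s → 1`. -/
lemma Regular.exists_primeZeta_bound [Countable P] (R : Regular N Y κ θ C q) :
    ∃ B, ∀ s, 1 < s → s ≤ 3 → |∑' p, (N p : ℝ) ^ (-s) - Real.log (1 / (s - 1))| ≤ B := by
  obtain ⟨c, K, hc, hK, h⟩ := R.exists_zeta_bounds
  set B₂ := ∑' p, (N p : ℝ) ^ (-2 : ℝ)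
  have hB₂ : 0 ≤ B₂ := tsum_nonneg fun p => Real.rpow_nonneg (Nat.cast_nonneg _) _
  have hN := R.one_lt
  refine ⟨|Real.log c| + |Real.log (K * 3)| + Real.log 2 + 2 * B₂, fun s hs hs3 => ?_⟩
  obtain ⟨hsum, hlow, hup⟩ := h s hs
  have hs0 : 0 < s := by linarith
  have hs1 : 0 < s - 1 := by linarith
  have hζ : 0 < zeta N s := lt_of_lt_of_le (by positivity) hlow
  have ht0 : ∀ p, 0 ≤ (N p : ℝ) ^ (-s) := fun p => Real.rpow_nonneg (Nat.cast_nonneg _) _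
  have ht1 : ∀ p, (N p : ℝ) ^ (-s) ≤ 1 / 2 := fun p => rpow_neg_le_half (hN p) hs.le
  have hsp := summable_prime_rpow hsum
  have hlogup : Real.log (zeta N s) ≤ |Real.log (K * 3)| + Real.log (1 / (s - 1)) := by
    calc Real.log (zeta N s) ≤ Real.log (K * 3 * (1 / (s - 1))) := by
          refine Real.log_le_log hζ (hup.trans ?_)
          rw [mul_one_div]; gcongr
      _ = Real.log (K * 3) + Real.log (1 / (s - 1)) :=
          Real.log_mul (by positivity) (by positivity)
      _ ≤ _ := by gcongr; exact le_abs_self _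
  have hloglow : -|Real.log c| + Real.log (1 / (s - 1)) ≤ Real.log (zeta N s) := by
    calc -|Real.log c| + Real.log (1 / (s - 1)) ≤ Real.log c + Real.log (1 / (s - 1)) := by
          gcongr; exact neg_abs_le _
      _ = Real.log (c * (1 / (s - 1))) := (Real.log_mul (by positivity) (by positivity)).symm
      _ ≤ Real.log (zeta N s) := by
          refine Real.log_le_log (by positivity) (le_trans ?_ hlow)
          rw [mul_one_div]
          gcongr
          nlinarith
  -- The zero element survives every sieve, so each partial product times `ζ(s)` is at least 1. Then
  -- use `1 - t ≤ exp(-t)`.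
  have hP : ∑' p, (N p : ℝ) ^ (-s) ≤ Real.log (zeta N s) := by
    refine hsp.tsum_le_of_sum_le fun Q => ?_
    rw [Real.le_log_iff_exp_le hζ]
    have h1 : 1 ≤ (∏ p ∈ Q, (1 - (N p : ℝ) ^ (-s))) * zeta N s := by
      rw [← tsum_sifted hsum]
      have := (hsum.indicator (sifted Q fun _ => 1)).le_tsum 0 (fun m _ =>
        Set.indicator_nonneg (fun _ _ => Real.rpow_nonneg (Nat.cast_nonneg _) _) m)
      refine le_trans (le_of_eq ?_) this
      rw [Set.indicator_of_mem (by intro p _; simp)]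
      simp [norm_zero]
    have h2 : ∏ p ∈ Q, (1 - (N p : ℝ) ^ (-s)) ≤ Real.exp (-∑ p ∈ Q, (N p : ℝ) ^ (-s)) := by
      rw [← Finset.sum_neg_distrib, Real.exp_sum]
      refine Finset.prod_le_prod (fun p _ => by linarith [ht1 p]) fun p _ => ?_
      linarith [Real.add_one_le_exp (-(N p : ℝ) ^ (-s))]
    have h3 := h1.trans (mul_le_mul_of_nonneg_right h2 hζ.le)
    rw [Real.exp_neg, inv_mul_eq_div, one_le_div (Real.exp_pos _)] at h3
    exact h3
  -- The converse uses a sieve that leaves at most 2, together with `1 - t ≥ exp(-t - 2t²)`. The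
  -- quadratic terms are dominated by the convergent sum at `s = 2`.
  have hP' : Real.log (zeta N s) ≤ Real.log 2 + ∑' p, (N p : ℝ) ^ (-s) + 2 * B₂ := by
    obtain ⟨Q, hQ⟩ := exists_tsum_sifted_le hsum
    rw [tsum_sifted hsum] at hQ
    have h1 : Real.exp (-(∑' p, (N p : ℝ) ^ (-s) + 2 * B₂))
        ≤ ∏ p ∈ Q, (1 - (N p : ℝ) ^ (-s)) := by
      calc _ ≤ Real.exp (∑ p ∈ Q, -((N p : ℝ) ^ (-s) + 2 * ((N p : ℝ) ^ (-s)) ^ 2)) := by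
            rw [Finset.sum_neg_distrib, Finset.sum_add_distrib, ← Finset.mul_sum]
            gcongr
            · exact hsp.sum_le_tsum _ fun p _ => ht0 p
            · refine le_trans (Finset.sum_le_sum (g := fun p => (N p : ℝ) ^ (-2 : ℝ)) ?_)
                ((R.summable_prime one_lt_two).sum_le_tsum _
                  fun p _ => Real.rpow_nonneg (Nat.cast_nonneg _) _)
              intro p _
              rw [← Real.rpow_natCast, ← Real.rpow_mul (Nat.cast_nonneg _)]
              refine Real.rpow_le_rpow_of_exponent_le (by exact_mod_cast (hN p).le) ?_
              push_cast
              linarith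
        _ ≤ _ := by
            rw [Real.exp_sum]
            exact Finset.prod_le_prod (fun _ _ => (Real.exp_pos _).le)
              fun p _ => exp_neg_le_one_sub (ht0 p) (ht1 p)
    have h2 := (mul_le_mul_of_nonneg_right h1 hζ.le).trans hQ
    rw [Real.exp_neg, inv_mul_eq_div, div_le_iff₀ (Real.exp_pos _)] at h2
    have h3 := Real.log_le_log hζ h2
    rw [Real.log_mul two_ne_zero (Real.exp_pos _).ne', Real.log_exp] at h3
    linarith
  have hl2 : 0 ≤ Real.log 2 := Real.log_nonneg one_le_two
  have := abs_nonneg (Real.log c)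
  have := abs_nonneg (Real.log (K * 3))
  rw [abs_le]
  constructor <;> linarith

/-- The generators of norm at most `x`. -/
noncomputable def Regular.primesBelow (R : Regular N Y κ θ C q) (x : ℝ) : Finset P :=
  (R.finite_primes x).toFinset

lemma Regular.mem_primesBelow (R : Regular N Y κ θ C q) {x : ℝ} {p : P} :
    p ∈ R.primesBelow x ↔ (N p : ℝ) ≤ x := by
  simp [primesBelow]

/-- A Mertens type theorem. -/
lemma Regular.exists_mertens [Countable P] (R : Regular N Y κ θ C q) :
    ∃ B, ∀ x, Real.exp 1 ≤ x →
      |∑ p ∈ R.primesBelow x, (N p : ℝ)⁻¹ - Real.log (Real.log x)| ≤ B := by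
  classical
  obtain ⟨B, hB⟩ := R.exists_primeZeta_bound
  refine ⟨B + 3 * (2 * B + Real.log 2), fun x hx => ?_⟩
  have hx0 : 0 < x := (Real.exp_pos 1).trans_le hx
  have hlog : 1 ≤ Real.log x := (Real.le_log_iff_exp_le hx0).2 hx
  -- With this choice `N(p)^δ` equals `e` exactly at `N(p) = x`, so the value of `N(p)^(-δ)` detects
  -- whether `N(p) ≤ x`.
  set δ := 1 / Real.log x
  have hδ0 : 0 < δ := by positivity
  have hδ1 : δ ≤ 1 := by rw [div_le_one (by positivity)]; exact hlog
  have hxδ : x ^ δ = Real.exp 1 := by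
    rw [Real.rpow_def_of_pos hx0, mul_one_div_cancel (by positivity)]
  have h1 := hB (1 + δ) (by linarith) (by linarith)
  have h2 := hB (1 + 2 * δ) (by linarith) (by linarith)
  have e1 : Real.log (1 / (1 + δ - 1)) = Real.log (Real.log x) := by
    rw [add_sub_cancel_left, one_div_one_div]
  have e2 : Real.log (1 / (1 + 2 * δ - 1)) = Real.log (Real.log x) - Real.log 2 := by
    rw [add_sub_cancel_left, ← Real.log_div (by positivity) two_ne_zero]
    congr 1
    simp only [δ]
    field_simp
  rw [e1] at h1
  rw [e2] at h2
  have s1 : Summable fun p => (N p : ℝ) ^ (-(1 + δ)) := R.summable_prime (by linarith)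
  have s2 : Summable fun p => (N p : ℝ) ^ (-(1 + 2 * δ)) := R.summable_prime (by linarith)
  set S : Set P := ↑(R.primesBelow x)
  set g : P → ℝ := S.indicator fun p => (N p : ℝ)⁻¹
  have hg : ∑ p ∈ R.primesBelow x, (N p : ℝ)⁻¹ = ∑' p, g p :=
    sum_eq_tsum_indicator _ _
  have sg : Summable g := by
    refine summable_of_hasFiniteSupport ((R.primesBelow x).finite_toSet.subset ?_)
    exact Set.support_indicator_subset
  -- With `v = N(p)^(-δ)`, the indicator of `N(p) ≤ x` lies between `v - 2(v - v²)` and `v + 3(v -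
  -- v²)`. This uses only `1/3 ≤ v ≤ 1` inside and `0 < v ≤ 1/2` outside. The sums of `v/N(p)` and
  -- `v²/N(p)` are the values at `1 + δ` and `1 + 2δ`, which differ by at most `2B + log 2`.
  have key : ∀ p, (N p : ℝ) ^ (-(1 + δ))
      - 2 * ((N p : ℝ) ^ (-(1 + δ)) - (N p : ℝ) ^ (-(1 + 2 * δ))) ≤ g p ∧
      g p ≤ (N p : ℝ) ^ (-(1 + δ))
      + 3 * ((N p : ℝ) ^ (-(1 + δ)) - (N p : ℝ) ^ (-(1 + 2 * δ))) := by
    intro p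
    have hNp : (1 : ℝ) < N p := by exact_mod_cast R.one_lt p
    have hNp0 : (0 : ℝ) < N p := by linarith
    set w := (N p : ℝ) ^ δ
    have hw : 1 ≤ w := Real.one_le_rpow hNp.le hδ0.le
    have r1 : (N p : ℝ) ^ (-(1 + δ)) = (N p : ℝ)⁻¹ * w⁻¹ := by
      rw [neg_add, Real.rpow_add hNp0, Real.rpow_neg_one, Real.rpow_neg hNp0.le]
    have r2 : (N p : ℝ) ^ (-(1 + 2 * δ)) = (N p : ℝ)⁻¹ * w⁻¹ * w⁻¹ := by
      rw [show -(1 + 2 * δ) = -1 + -δ + -δ by ring, Real.rpow_add hNp0, Real.rpow_add hNp0,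
        Real.rpow_neg_one, Real.rpow_neg hNp0.le]
    rw [r1, r2]
    have hi : 0 < (N p : ℝ)⁻¹ := inv_pos.2 hNp0
    set v := w⁻¹
    have hv0 : 0 < v := inv_pos.2 (by linarith)
    have hv1 : v ≤ 1 := inv_le_one_of_one_le₀ hw
    by_cases hp : p ∈ S
    · have hpx : (N p : ℝ) ≤ x := R.mem_primesBelow.1 hp
      have hw3 : w ≤ 3 := by
        calc w ≤ x ^ δ := Real.rpow_le_rpow hNp0.le hpx hδ0.le
          _ ≤ 3 := by rw [hxδ]; linarith [Real.exp_one_lt_d9]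
      have hv3 : 1 / 3 ≤ v := by
        rw [one_div]; exact inv_anti₀ (by linarith) hw3
      simp only [g, Set.indicator_of_mem hp]
      constructor
      · have : 0 ≤ (N p : ℝ)⁻¹ * (1 - v) := mul_nonneg hi.le (by linarith)
        have : 0 ≤ (N p : ℝ)⁻¹ * (v * (1 - v)) :=
          mul_nonneg hi.le (mul_nonneg hv0.le (by linarith))
        nlinarith
      · have : 0 ≤ (N p : ℝ)⁻¹ * ((1 - v) * (3 * v - 1)) :=
          mul_nonneg hi.le (mul_nonneg (by linarith) (by linarith))
        nlinarith
    · have hpx : x < (N p : ℝ) := not_le.1 fun h => hp (R.mem_primesBelow.2 h)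
      have hw2 : 2 ≤ w := by
        calc (2 : ℝ) ≤ x ^ δ := by rw [hxδ]; linarith [Real.exp_one_gt_d9]
          _ ≤ w := Real.rpow_le_rpow hx0.le hpx.le hδ0.le
      have hv2 : v ≤ 1 / 2 := by
        rw [one_div]; exact inv_anti₀ two_pos hw2
      simp only [g, Set.indicator_of_notMem hp]
      have : 0 ≤ (N p : ℝ)⁻¹ * (v * (1 - 2 * v)) :=
        mul_nonneg hi.le (mul_nonneg hv0.le (by linarith))
      have : 0 ≤ (N p : ℝ)⁻¹ * (v * (1 - v)) :=
        mul_nonneg hi.le (mul_nonneg hv0.le (by linarith))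
      have : 0 < (N p : ℝ)⁻¹ * v := by positivity
      constructor <;> nlinarith
  have sd := s1.sub s2
  have u1 := (s1.sub (sd.mul_left 2)).tsum_le_tsum (fun p => (key p).1) sg
  have u2 := sg.tsum_le_tsum (fun p => (key p).2) (s1.add (sd.mul_left 3))
  rw [s1.tsum_sub (sd.mul_left 2), tsum_mul_left, s1.tsum_sub s2] at u1
  rw [s1.tsum_add (sd.mul_left 3), tsum_mul_left, s1.tsum_sub s2] at u2
  rw [hg]
  rw [abs_le] at h1 h2 ⊢
  have hl2 : 0 ≤ Real.log 2 := Real.log_nonneg one_le_two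
  have : 0 ≤ B := by linarith
  constructor <;> linarith [h1.1, h1.2, h2.1, h2.2]

end AbelianMonoid

/-! ### Truncated inclusion-exclusion for generating functions. -/

namespace AbelianMonoid

/-- Truncating the binomial expansion of a power of a number of the unit disc. -/
lemma norm_pow_sub_sum_choose_le {z : ℂ} (hz : ‖1 + z‖ ≤ 1) (n r : ℕ) :
    ‖(1 + z) ^ n - ∑ j ∈ Finset.range r, (n.choose j : ℂ) * z ^ j‖ ≤ n.choose r * ‖z‖ ^ r := by
  induction n generalizing r with
  | zero =>
    cases r with
    | zero => simp
    | succ r => simp [Finset.sum_range_succ']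
  | succ n ih =>
    cases r with
    | zero => simpa using pow_le_one₀ (norm_nonneg _) hz
    | succ r =>
      -- Pascal's rule gives the remainder of order `r + 1` at `n + 1` as the one at `n` plus `z`
      -- times the remainder of order `r`.
      have h : (1 + z) ^ (n + 1) - ∑ j ∈ Finset.range (r + 1), ((n + 1).choose j : ℂ) * z ^ j
          = ((1 + z) ^ n - ∑ j ∈ Finset.range (r + 1), (n.choose j : ℂ) * z ^ j)
            + z * ((1 + z) ^ n - ∑ j ∈ Finset.range r, (n.choose j : ℂ) * z ^ j) := by
        rw [Finset.sum_range_succ', Finset.sum_range_succ' (fun j => (n.choose j : ℂ) * z ^ j),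
          mul_sub, Finset.mul_sum]
        simp only [Nat.choose_succ_succ, Nat.cast_add, add_mul, Finset.sum_add_distrib]
        have : ∀ j, (n.choose j : ℂ) * z ^ (j + 1) = z * ((n.choose j : ℂ) * z ^ j) := by
          intro j; ring
        simp only [this, Nat.choose_zero_right]
        ring
      rw [h]
      refine (norm_add_le _ _).trans ((add_le_add (ih (r + 1))
        ((norm_mul_le _ _).trans (mul_le_mul_of_nonneg_left (ih r) (norm_nonneg _)))).trans
        (le_of_eq ?_))
      rw [Nat.choose_succ_succ]
      push_cast
      ring

lemma sum_range_powersetCard {α β : Type*} [AddCommMonoid β] [DecidableEq α] (Q : Finset α) (r : ℕ)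
    (g : Finset α → β) :
    ∑ j ∈ Finset.range r, ∑ d ∈ Q.powersetCard j, g d
      = ∑ d ∈ Q.powerset with d.card < r, g d := by
  rw [← Finset.sum_fiberwise_of_maps_to (s := Q.powerset.filter fun d => d.card < r)
    (t := Finset.range r) (g := Finset.card) (fun d hd => by
      simpa using (Finset.mem_filter.1 hd).2)]
  refine Finset.sum_congr rfl fun j hj => Finset.sum_congr ?_ fun _ _ => rfl
  ext d
  simp only [Finset.mem_powersetCard, Finset.mem_filter, Finset.mem_powerset]
  have := Finset.mem_range.1 hj
  constructor
  · rintro ⟨h1, h2⟩; exact ⟨⟨h1, by omega⟩, h2⟩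
  · rintro ⟨⟨h1, -⟩, h2⟩; exact ⟨h1, h2⟩

/-- Double counting of pairs `(m, d)` in which `m` has the property at every element of `d`. -/
lemma sum_powersetCard_filter {ι α : Type*} [DecidableEq α] (S : Finset ι) (Q : Finset α) (ind : ι → α → Prop)
    [∀ m, DecidablePred (ind m)] (j : ℕ) (g : Finset α → ℂ) :
    ∑ m ∈ S, ∑ d ∈ (Q.filter (ind m)).powersetCard j, g d
      = ∑ d ∈ Q.powersetCard j, ((S.filter fun m => ∀ p ∈ d, ind m p).card : ℂ) * g d := by
  have h : ∀ m, (Q.filter (ind m)).powersetCard j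
      = (Q.powersetCard j).filter fun d => ∀ p ∈ d, ind m p := by
    intro m
    ext d
    simp only [Finset.mem_powersetCard, Finset.mem_filter, Finset.subset_iff]
    constructor
    · rintro ⟨h1, h2⟩; exact ⟨⟨fun p hp => (h1 hp).1, h2⟩, fun p hp => (h1 hp).2⟩
    · rintro ⟨⟨h1, h2⟩, h3⟩; exact ⟨fun p hp => ⟨h1 hp, h3 p hp⟩, h2⟩
  simp only [h, Finset.sum_filter]
  rw [Finset.sum_comm]
  refine Finset.sum_congr rfl fun d _ => ?_
  rw [← Finset.sum_filter, Finset.sum_const, nsmul_eq_mul]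

/-- The part of the expansion of `∏ (1 + a f)` with at least `r` factors. -/
lemma sum_card_ge_le {α : Type*} [DecidableEq α] (Q : Finset α) {f : α → ℝ}
    (hf : ∀ p ∈ Q, 0 ≤ f p) {a : ℝ} (ha : 0 ≤ a) (r : ℕ) :
    ∑ d ∈ Q.powerset with ¬ d.card < r, a ^ d.card * ∏ p ∈ d, f p
      ≤ (1 / 2) ^ r * Real.exp (2 * a * ∑ p ∈ Q, f p) := by
  have hpos : ∀ d ∈ Q.powerset, 0 ≤ ∏ p ∈ d, (2 * a * f p) := fun d hd =>
    Finset.prod_nonneg fun p hp => by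
      have := hf p (Finset.mem_powerset.1 hd hp); positivity
  calc ∑ d ∈ Q.powerset with ¬ d.card < r, a ^ d.card * ∏ p ∈ d, f p
      ≤ ∑ d ∈ Q.powerset with ¬ d.card < r, (1 / 2) ^ r * ∏ p ∈ d, (2 * a * f p) := by
        refine Finset.sum_le_sum fun d hd => ?_
        obtain ⟨hdQ, hr⟩ := Finset.mem_filter.1 hd
        -- Rankin's trick: extracting `2^(-|d|)`, at most `2^(-r)` here, allows the sum to be
        -- completed to all subsets.
        have hprod : a ^ d.card * ∏ p ∈ d, f p = (1 / 2) ^ d.card * ∏ p ∈ d, (2 * a * f p) := by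
          rw [Finset.prod_mul_distrib, Finset.prod_const, ← mul_assoc, ← mul_pow]
          congr 2
          ring
        rw [hprod]
        exact mul_le_mul_of_nonneg_right
          (pow_le_pow_of_le_one (by norm_num) (by norm_num) (not_lt.1 hr)) (hpos d hdQ)
    _ = (1 / 2) ^ r * ∑ d ∈ Q.powerset with ¬ d.card < r, ∏ p ∈ d, (2 * a * f p) := by
        rw [Finset.mul_sum]
    _ ≤ (1 / 2) ^ r * ∑ d ∈ Q.powerset, ∏ p ∈ d, (2 * a * f p) :=
        mul_le_mul_of_nonneg_left (Finset.sum_le_sum_of_subset_of_nonneg (Finset.filter_subset _ _)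
          fun d hd _ => hpos d hd) (by positivity)
    _ ≤ _ := by
        rw [← Finset.prod_one_add, Finset.mul_sum, Real.exp_sum]
        refine mul_le_mul_of_nonneg_left (Finset.prod_le_prod (fun p hp => ?_) fun p hp => ?_)
          (by positivity)
        · have := hf p hp
          positivity
        · linarith [Real.add_one_le_exp (2 * a * f p)]

/-- The generating function of the number of `p ∈ Q` with the property `ind · p`, for a finite
family in which such properties are almost independent, with frequencies `f p`. -/
lemma norm_sum_pow_sub_prod_le {ι α : Type*} [DecidableEq α] (S : Finset ι) (Q : Finset α)
    (ind : ι → α → Prop) [∀ m, DecidablePred (ind m)] {f : α → ℝ} (hf : ∀ p ∈ Q, 0 ≤ f p)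
    {M E : ℝ} (hM : 0 ≤ M) (hE : 0 ≤ E) {r : ℕ}
    (hc : ∀ d ⊆ Q, d.card ≤ r →
      |((S.filter fun m => ∀ p ∈ d, ind m p).card : ℝ) - M * ∏ p ∈ d, f p| ≤ E)
    {z : ℂ} (hz : ‖1 + z‖ ≤ 1) (hz2 : ‖z‖ ≤ 2) :
    ‖∑ m ∈ S, (1 + z) ^ (Q.filter (ind m)).card - M * ∏ p ∈ Q, (1 + z * f p)‖
      ≤ E * (2 * Q.card + 1) ^ r + 2 * M * ((1 / 2) ^ r * Real.exp (2 * ‖z‖ * ∑ p ∈ Q, f p)) := by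
  set c : Finset α → ℕ := fun d => (S.filter fun m => ∀ p ∈ d, ind m p).card with hcdef
  have hcc : ∀ d, (S.filter fun m => ∀ p ∈ d, ind m p).card = c d := fun _ => rfl
  set T := (1 / 2 : ℝ) ^ r * Real.exp (2 * ‖z‖ * ∑ p ∈ Q, f p)
  have hfd : ∀ d ⊆ Q, 0 ≤ ∏ p ∈ d, f p := fun d hd =>
    Finset.prod_nonneg fun p hp => hf p (hd hp)
  -- truncation
  have h1 : ‖∑ m ∈ S, (1 + z) ^ (Q.filter (ind m)).card
      - ∑ d ∈ Q.powerset with d.card < r, (c d : ℂ) * z ^ d.card‖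
      ≤ ∑ d ∈ Q.powersetCard r, (c d : ℝ) * ‖z‖ ^ r := by
    have e1 : ∑ d ∈ Q.powerset with d.card < r, (c d : ℂ) * z ^ d.card
        = ∑ m ∈ S, ∑ j ∈ Finset.range r, ((Q.filter (ind m)).card.choose j : ℂ) * z ^ j := by
      rw [← sum_range_powersetCard, Finset.sum_comm]
      refine Finset.sum_congr rfl fun j _ => ?_
      have := sum_powersetCard_filter S Q ind j fun d => z ^ d.card
      simp only [hcdef]
      rw [← this]
      refine Finset.sum_congr rfl fun m _ => ?_
      rw [Finset.sum_congr rfl (g := fun _ => z ^ j)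
        (fun d hd => by rw [(Finset.mem_powersetCard.1 hd).2]), Finset.sum_const,
        Finset.card_powersetCard, nsmul_eq_mul]
    have e2 : ∑ d ∈ Q.powersetCard r, (c d : ℝ) * ‖z‖ ^ r
        = ∑ m ∈ S, ((Q.filter (ind m)).card.choose r : ℝ) * ‖z‖ ^ r := by
      have := sum_powersetCard_filter S Q ind r fun _ => ((‖z‖ ^ r : ℝ) : ℂ)
      simp only [Finset.sum_const, Finset.card_powersetCard, nsmul_eq_mul] at this
      simp only [hcdef]
      have h' : ((∑ m ∈ S, ((Q.filter (ind m)).card.choose r : ℝ) * ‖z‖ ^ r : ℝ) : ℂ)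
          = ((∑ d ∈ Q.powersetCard r, (c d : ℝ) * ‖z‖ ^ r : ℝ) : ℂ) := by
        push_cast
        push_cast at this
        exact this
      exact (Complex.ofReal_injective h').symm
    rw [e1, e2, ← Finset.sum_sub_distrib]
    exact norm_sum_le_of_le _ fun m _ => norm_pow_sub_sum_choose_le hz _ _
  -- The truncation remainder involves only sets of size exactly `r`. Replacing their counts by the
  -- expected ones turns it into a part of the tail `T`, plus accumulated errors `E`.
  have h1' : ∑ d ∈ Q.powersetCard r, (c d : ℝ) * ‖z‖ ^ r
      ≤ M * T + E * ∑ d ∈ Q.powersetCard r, ‖z‖ ^ r := by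
    have : ∑ d ∈ Q.powersetCard r, ‖z‖ ^ d.card * ∏ p ∈ d, f p ≤ T := by
      refine le_trans (Finset.sum_le_sum_of_subset_of_nonneg ?_ ?_)
        (sum_card_ge_le Q hf (norm_nonneg z) r)
      · intro d hd
        obtain ⟨a, b⟩ := Finset.mem_powersetCard.1 hd
        simp [a, b]
      · intro d hd _
        have := hfd d (Finset.mem_powerset.1 (Finset.mem_filter.1 hd).1)
        positivity
    calc ∑ d ∈ Q.powersetCard r, (c d : ℝ) * ‖z‖ ^ r
        ≤ ∑ d ∈ Q.powersetCard r,
          (M * (‖z‖ ^ d.card * ∏ p ∈ d, f p) + E * ‖z‖ ^ r) := by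
          refine Finset.sum_le_sum fun d hd => ?_
          obtain ⟨a, b⟩ := Finset.mem_powersetCard.1 hd
          have h := (abs_le.1 (hc d a b.le)).2
          rw [hcc] at h
          rw [b]
          have : (c d : ℝ) ≤ M * ∏ p ∈ d, f p + E := by linarith
          calc (c d : ℝ) * ‖z‖ ^ r ≤ (M * ∏ p ∈ d, f p + E) * ‖z‖ ^ r := by gcongr
            _ = _ := by ring
      _ ≤ _ := by
          rw [Finset.sum_add_distrib, ← Finset.mul_sum, ← Finset.mul_sum]
          gcongr
  -- comparison of the truncated sums
  have h2 : ‖∑ d ∈ Q.powerset with d.card < r, (c d : ℂ) * z ^ d.card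
      - M * ∑ d ∈ Q.powerset with d.card < r, z ^ d.card * ∏ p ∈ d, (f p : ℂ)‖
      ≤ E * ∑ j ∈ Finset.range r, ∑ d ∈ Q.powersetCard j, ‖z‖ ^ j := by
    have e : ∑ j ∈ Finset.range r, ∑ d ∈ Q.powersetCard j, ‖z‖ ^ j
        = ∑ d ∈ Q.powerset with d.card < r, ‖z‖ ^ d.card := by
      rw [← sum_range_powersetCard]
      exact Finset.sum_congr rfl fun j _ => Finset.sum_congr rfl fun d hd => by
        rw [(Finset.mem_powersetCard.1 hd).2]
    rw [e, Finset.mul_sum, Finset.mul_sum, ← Finset.sum_sub_distrib]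
    refine norm_sum_le_of_le _ fun d hd => ?_
    obtain ⟨a, b⟩ := Finset.mem_filter.1 hd
    have h := hc d (Finset.mem_powerset.1 a) b.le
    rw [hcc] at h
    have : (c d : ℂ) * z ^ d.card - M * (z ^ d.card * ∏ p ∈ d, (f p : ℂ))
        = (((c d : ℝ) - M * ∏ p ∈ d, f p : ℝ) : ℂ) * z ^ d.card := by
      push_cast; ring
    rw [this, norm_mul, norm_pow, Complex.norm_real]
    exact mul_le_mul_of_nonneg_right h (by positivity)
  have h3 : ‖M * ∑ d ∈ Q.powerset with d.card < r, z ^ d.card * ∏ p ∈ d, (f p : ℂ)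
      - M * ∏ p ∈ Q, (1 + z * f p)‖ ≤ M * T := by
    have e : ∏ p ∈ Q, (1 + z * f p)
        = ∑ d ∈ Q.powerset with d.card < r, z ^ d.card * ∏ p ∈ d, (f p : ℂ)
          + ∑ d ∈ Q.powerset with ¬ d.card < r, z ^ d.card * ∏ p ∈ d, (f p : ℂ) := by
      rw [Finset.sum_filter_add_sum_filter_not, Finset.prod_one_add]
      simp only [Finset.prod_mul_distrib, Finset.prod_const]
    rw [e, ← mul_sub, sub_add_cancel_left, norm_mul, norm_neg, Complex.norm_real,
      Real.norm_of_nonneg hM]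
    gcongr
    refine le_trans (norm_sum_le_of_le _ fun d hd => ?_) (sum_card_ge_le Q hf (norm_nonneg z) r)
    have := hfd d (Finset.mem_powerset.1 (Finset.mem_filter.1 hd).1)
    rw [norm_mul, norm_pow, ← Complex.ofReal_prod, Complex.norm_real, Real.norm_of_nonneg this]
  -- Term-by-term comparison with the binomial expansion of `(2|Q| + 1)^r`: each `binom(|Q|, j)
  -- ‖z‖^j` is at most `(2|Q|)^j`, and the coefficient `binom(r, j)` is at least 1.
  have h4 : ∑ j ∈ Finset.range r, ∑ d ∈ Q.powersetCard j, ‖z‖ ^ j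
      + ∑ d ∈ Q.powersetCard r, ‖z‖ ^ r ≤ (2 * Q.card + 1) ^ r := by
    rw [← Finset.sum_range_succ (fun j => ∑ d ∈ Q.powersetCard j, ‖z‖ ^ j), add_pow]
    refine Finset.sum_le_sum fun j hj => ?_
    rw [Finset.sum_const, Finset.card_powersetCard, nsmul_eq_mul, one_pow, mul_one]
    have hjr : 1 ≤ r.choose j := Nat.choose_pos (Nat.lt_succ_iff.1 (Finset.mem_range.1 hj))
    have hq : (Q.card.choose j : ℝ) ≤ (Q.card : ℝ) ^ j := by
      exact_mod_cast Nat.choose_le_pow _ _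
    calc (Q.card.choose j : ℝ) * ‖z‖ ^ j ≤ (Q.card : ℝ) ^ j * 2 ^ j :=
          mul_le_mul hq (pow_le_pow_left₀ (norm_nonneg z) hz2 j)
            (pow_nonneg (norm_nonneg z) j) (pow_nonneg (Nat.cast_nonneg _) j)
      _ = (2 * Q.card : ℝ) ^ j * (1 : ℕ) := by rw [mul_pow]; push_cast; ring
      _ ≤ _ := mul_le_mul_of_nonneg_left (by exact_mod_cast hjr)
          (pow_nonneg (mul_nonneg two_pos.le (Nat.cast_nonneg _)) j)
  have h5 := mul_le_mul_of_nonneg_left h4 hE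
  rw [mul_add] at h5
  have h6 := norm_sub_le_norm_sub_add_norm_sub
    (∑ m ∈ S, (1 + z) ^ (Q.filter (ind m)).card)
    (∑ d ∈ Q.powerset with d.card < r, (c d : ℂ) * z ^ d.card) (M * ∏ p ∈ Q, (1 + z * f p))
  have h7 := norm_sub_le_norm_sub_add_norm_sub
    (∑ d ∈ Q.powerset with d.card < r, (c d : ℂ) * z ^ d.card)
    (M * ∑ d ∈ Q.powerset with d.card < r, z ^ d.card * ∏ p ∈ d, (f p : ℂ))
    (M * ∏ p ∈ Q, (1 + z * f p))
  linarith

end AbelianMonoid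

/-! ### Counting `h`-free elements with prescribed simple generators. -/

namespace AbelianMonoid

variable {P : Type*} {N : P → ℕ} {Y : Set ℝ} {κ θ C q : ℝ}

/-- The `h`-free elements in which every `p ∈ d` occurs with multiplicity exactly one. -/
def hFreeExact (h : ℕ) (d : Finset P) : Set (FreeMon P) := {m | m ∈ hFree P h ∧ ∀ p ∈ d, m p = 1}

lemma mem_hFree_iff {h : ℕ} (hh : 2 ≤ h) {m : FreeMon P} : m ∈ hFree P h ↔ ∀ p, m p < h := by
  simp only [hFree, Set.mem_ofPred_eq, Finsupp.mem_support_iff]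
  constructor
  · intro H p
    by_cases hp : m p = 0
    · omega
    · have := H p hp; omega
  · intro H p _
    have := H p; omega

lemma norm_sum_single (N : P → ℕ) (d : Finset P) :
    norm N (∑ p ∈ d, Finsupp.single p 1) = ∏ p ∈ d, N p := by
  classical
  induction d using Finset.induction_on with
  | empty => simp [norm_zero]
  | insert p d hp ih => rw [Finset.sum_insert hp, norm_add, ih, norm_single, Finset.prod_insert hp,
      pow_one]

/-- Removing one copy of each `p ∈ d` leaves an element free of `d` and still `h`-free elsewhere.
The second alternative plays the role of the hypothesis `d ⊆ R.primesBelow x`. -/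
lemma Regular.cnt_hFreeExact [DecidableEq P] (R : Regular N Y κ θ C q) {h : ℕ} (hh : 2 ≤ h)
    (d : Finset P) (x : ℝ) :
    cnt N (hFreeExact h d) x
      = cnt N (sifted (R.primesBelow x) fun p => if p ∈ d then 1 else h) (x / ∏ p ∈ d, (N p : ℝ))
    ∨ ¬ d ⊆ R.primesBelow x := by
  by_cases hd : d ⊆ R.primesBelow x
  swap
  · exact Or.inr hd
  refine Or.inl ?_
  set e : FreeMon P := ∑ p ∈ d, Finsupp.single p 1
  have he : ∀ p, e p = if p ∈ d then 1 else 0 := by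
    intro p
    simp [e, Finsupp.finsetSum_apply, Finsupp.single_apply]
  have hnorm : ∀ n : FreeMon P, (norm N (n + e) : ℝ) = norm N n * ∏ p ∈ d, (N p : ℝ) := by
    intro n
    rw [norm_add, norm_sum_single]
    push_cast
    rfl
  have hpos : (1 : ℝ) ≤ ∏ p ∈ d, (N p : ℝ) :=
    Finset.one_le_prod fun p _ => by exact_mod_cast (R.one_lt p).le
  have himg : below N (hFreeExact h d) x = (fun n => n + e) ''
      below N (sifted (R.primesBelow x) fun p => if p ∈ d then 1 else h)
        (x / ∏ p ∈ d, (N p : ℝ)) := by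
    ext m
    simp only [below, Set.mem_image, Set.mem_ofPred_eq, hFreeExact, mem_hFree_iff hh, sifted]
    constructor
    · rintro ⟨⟨h1, h2⟩, h3⟩
      have hem : e ≤ m := by
        intro p
        rw [he]
        split_ifs with hp
        · rw [h2 p hp]
        · exact Nat.zero_le _
      have hsub : m - e + e = m := tsub_add_cancel_of_le hem
      refine ⟨m - e, ⟨fun p hp => ?_, ?_⟩, hsub⟩
      · rw [Finsupp.tsub_apply, he]
        split_ifs with hpd
        · simp [h2 p hpd]
        · simpa using h1 p
      · rw [le_div_iff₀ (by linarith), ← hnorm, hsub]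
        exact h3
    · rintro ⟨n, ⟨h1, h2⟩, rfl⟩
      rw [le_div_iff₀ (by linarith), ← hnorm] at h2
      -- The sieve sees only generators of norm at most `x`, but no others can occur in an element
      -- of norm at most `x`.
      have hn : ∀ p, n p < if p ∈ d then 1 else h := by
        intro p
        by_cases hp : p ∈ R.primesBelow x
        · exact h1 p hp
        · have hpd : p ∉ d := fun h => hp (hd h)
          rw [if_neg hpd]
          by_contra hlt
          refine hp (R.mem_primesBelow.2 (le_trans ?_ h2))
          have : 1 ≤ (n + e) p := by
            rw [Finsupp.add_apply]; omega
          have := single_le_norm R.one_lt this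
          rw [pow_one] at this
          exact_mod_cast this
      refine ⟨⟨fun p => ?_, fun p hp => ?_⟩, h2⟩
      · have := hn p
        rw [Finsupp.add_apply, he]
        split_ifs at this ⊢ <;> omega
      · have := hn p
        rw [if_pos hp] at this
        rw [Finsupp.add_apply, he, if_pos hp]
        omega
  rw [cnt, himg, Set.ncard_image_of_injective _ (add_left_injective _), cnt]

/-- The density of the elements divisible exactly once by `p` among the `h`-free elements. -/
noncomputable def freq (N : P → ℕ) (h : ℕ) (p : P) : ℝ :=
  (N p : ℝ)⁻¹ * ((1 - (N p : ℝ)⁻¹) / (1 - (N p ^ h : ℝ)⁻¹))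

lemma inv_pow_le_inv_sq (hN : ∀ p, 1 < N p) {h : ℕ} (hh : 2 ≤ h) (p : P) :
    (N p ^ h : ℝ)⁻¹ ≤ (N p ^ 2 : ℝ)⁻¹ := by
  have : (1 : ℝ) ≤ N p := by exact_mod_cast (hN p).le
  have : (0 : ℝ) < N p := by linarith
  exact inv_anti₀ (by positivity) (pow_le_pow_right₀ (by assumption) hh)

lemma inv_sq_le_quarter (hN : ∀ p, 1 < N p) (p : P) : (N p ^ 2 : ℝ)⁻¹ ≤ 1 / 4 := by
  have : (2 : ℝ) ≤ N p := by exact_mod_cast hN p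
  rw [one_div]
  exact inv_anti₀ (by norm_num) (by nlinarith)

lemma one_sub_inv_pow_pos (hN : ∀ p, 1 < N p) {h : ℕ} (hh : 2 ≤ h) (p : P) :
    0 < 1 - (N p ^ h : ℝ)⁻¹ := by
  linarith [inv_pow_le_inv_sq hN hh p, inv_sq_le_quarter hN p]

lemma inv_le_half (hN : ∀ p, 1 < N p) (p : P) : (N p : ℝ)⁻¹ ≤ 1 / 2 := by
  have : (2 : ℝ) ≤ N p := by exact_mod_cast hN p
  rw [one_div]
  exact inv_anti₀ (by norm_num) this

/-- Since `freq` is `1/N(p)` up to `1/N(p)²`, its sums agree with the Mertens sums up to a bounded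
error. -/
lemma freq_bounds (hN : ∀ p, 1 < N p) {h : ℕ} (hh : 2 ≤ h) (p : P) :
    0 ≤ freq N h p ∧ freq N h p ≤ (N p : ℝ)⁻¹ ∧
      (N p : ℝ)⁻¹ - (N p ^ 2 : ℝ)⁻¹ ≤ freq N h p := by
  have h1 := one_sub_inv_pow_pos hN hh p
  have h2 := inv_le_half hN p
  have h3 : 0 ≤ (N p : ℝ)⁻¹ := by positivity
  have h5 : (N p ^ 2 : ℝ)⁻¹ = (N p : ℝ)⁻¹ * (N p : ℝ)⁻¹ := by rw [pow_two, mul_inv]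
  have h4 : (N p ^ h : ℝ)⁻¹ ≤ (N p : ℝ)⁻¹ := by
    refine (inv_pow_le_inv_sq hN hh p).trans ?_
    rw [h5]
    nlinarith
  have h6 : 0 ≤ (N p ^ h : ℝ)⁻¹ := by positivity
  unfold freq
  refine ⟨mul_nonneg h3 (div_nonneg (by linarith) h1.le), ?_, ?_⟩
  · exact mul_le_of_le_one_right h3 ((div_le_one h1).2 (by linarith))
  · rw [h5, ← mul_one_sub]
    refine mul_le_mul_of_nonneg_left ?_ h3
    rw [le_div_iff₀ h1]
    nlinarith

/-- The density of the elements free of `h`-th powers of generators of norm at most `x`. -/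
noncomputable def Regular.dens (R : Regular N Y κ θ C q) (h : ℕ) (x : ℝ) : ℝ :=
  ∏ p ∈ R.primesBelow x, (1 - (N p ^ h : ℝ)⁻¹)

lemma Regular.summable_inv_sq [Countable P] (R : Regular N Y κ θ C q) :
    Summable fun p => (N p ^ 2 : ℝ)⁻¹ := by
  refine (R.summable_prime one_lt_two).congr fun p => ?_
  rw [Real.rpow_neg (Nat.cast_nonneg _)]
  norm_num

/-- Convergence of the sum of `N(p)^(-2)` keeps the product away from 0, so the `h`-free elements
have positive density. -/
lemma Regular.exists_le_dens [Countable P] (R : Regular N Y κ θ C q) {h : ℕ} (hh : 2 ≤ h) :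
    ∃ ρ, 0 < ρ ∧ ∀ x, ρ ≤ R.dens h x := by
  refine ⟨Real.exp (-(2 * ∑' p, (N p ^ 2 : ℝ)⁻¹)), Real.exp_pos _, fun x => ?_⟩
  calc Real.exp (-(2 * ∑' p, (N p ^ 2 : ℝ)⁻¹))
      ≤ Real.exp (∑ p ∈ R.primesBelow x, -(2 * (N p ^ 2 : ℝ)⁻¹)) := by
        rw [Finset.sum_neg_distrib, ← Finset.mul_sum]
        gcongr
        exact R.summable_inv_sq.sum_le_tsum _ fun p _ => by positivity
    _ ≤ R.dens h x := by
        rw [Real.exp_sum]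
        refine Finset.prod_le_prod (fun _ _ => (Real.exp_pos _).le) fun p _ => ?_
        have h1 := inv_pow_le_inv_sq R.one_lt hh p
        have h2 := inv_sq_le_quarter R.one_lt p
        have h3 : 0 ≤ (N p ^ h : ℝ)⁻¹ := by positivity
        refine le_trans (Real.exp_le_exp.2 ?_) (exp_neg_le_one_sub h3 (by linarith))
        nlinarith

/-- The sieve is applied with exponent 1 on `d` and `h` elsewhere. In the error product each `p ∈ d`
costs at most a factor 2, apart from the convergent product over `N(p)^(-3/2)` that bounds the rest.
-/
lemma Regular.exists_cnt_hFreeExact [Countable P] (R : Regular N Y κ θ C q) {h : ℕ} (hh : 2 ≤ h) :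
    ∃ G, 0 ≤ G ∧ ∀ x ∈ Y, 0 < x → ∀ d ⊆ R.primesBelow x,
      |cnt N (hFreeExact h d) x - κ * R.dens h x * x * ∏ p ∈ d, freq N h p|
        ≤ G * x ^ θ * 2 ^ d.card := by
  classical
  set B := ∑' p, (N p : ℝ) ^ (-(3 / 2) : ℝ)
  refine ⟨C * Real.exp B, mul_nonneg R.C_nonneg (Real.exp_pos _).le, fun x hx hx0 d hd => ?_⟩
  have hN0 : ∀ p, (0 : ℝ) < N p := fun p => by exact_mod_cast zero_lt_one.trans (R.one_lt p)
  have hN1 : ∀ p, (1 : ℝ) ≤ N p := fun p => by exact_mod_cast (R.one_lt p).le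
  have hD : (1 : ℝ) ≤ ∏ p ∈ d, (N p : ℝ) := Finset.one_le_prod fun p _ => hN1 p
  set D := ∏ p ∈ d, (N p : ℝ)
  have hD0 : 0 < D := by linarith
  have hxY : x / D ∈ Y := by
    have := R.div_mem x hx (∑ p ∈ d, Finsupp.single p 1)
    rwa [norm_sum_single, Nat.cast_prod] at this
  rw [(R.cnt_hFreeExact hh d x).resolve_right (not_not.2 hd)]
  set k : P → ℕ := fun p => if p ∈ d then 1 else h
  have hmain := R.abs_cnt_sifted_sub_le (R.primesBelow x) k hxY (div_pos hx0 hD0)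
  have e1 : κ * (x / D) * ∏ p ∈ R.primesBelow x, (1 - (N p ^ k p : ℝ)⁻¹)
      = κ * R.dens h x * x * ∏ p ∈ d, freq N h p := by
    have h1 : ∏ p ∈ R.primesBelow x, (1 - (N p ^ k p : ℝ)⁻¹)
        = R.dens h x * ∏ p ∈ d, ((1 - (N p : ℝ)⁻¹) / (1 - (N p ^ h : ℝ)⁻¹)) := by
      have : ∏ p ∈ d, ((1 - (N p : ℝ)⁻¹) / (1 - (N p ^ h : ℝ)⁻¹))
          = ∏ p ∈ R.primesBelow x,
            if p ∈ d then ((1 - (N p : ℝ)⁻¹) / (1 - (N p ^ h : ℝ)⁻¹)) else 1 := by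
        rw [Finset.prod_ite_mem, Finset.inter_eq_right.2 hd]
      rw [this, dens, ← Finset.prod_mul_distrib]
      refine Finset.prod_congr rfl fun p _ => ?_
      by_cases hp : p ∈ d
      · simp only [k, hp, if_true, pow_one]
        rw [mul_div_cancel₀ _ (one_sub_inv_pow_pos R.one_lt hh p).ne']
      · simp [k, hp]
    rw [h1]
    simp only [freq, Finset.prod_mul_distrib, Finset.prod_inv_distrib]
    rw [div_eq_mul_inv]
    ring
  rw [e1] at hmain
  refine hmain.trans ?_
  have h2 : ∏ p ∈ R.primesBelow x, (1 + (N p ^ k p : ℝ)⁻¹ ^ θ) ≤ 2 ^ d.card * Real.exp B := by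
    have hθ : 0 ≤ θ := by linarith [R.le_θ]
    calc ∏ p ∈ R.primesBelow x, (1 + (N p ^ k p : ℝ)⁻¹ ^ θ)
        ≤ ∏ p ∈ R.primesBelow x,
          ((if p ∈ d then 2 else 1) * Real.exp ((N p : ℝ) ^ (-(3 / 2) : ℝ))) := by
          refine Finset.prod_le_prod (fun p _ => by positivity) fun p _ => ?_
          have hexp := Real.add_one_le_exp ((N p : ℝ) ^ (-(3 / 2) : ℝ))
          have h0 : 0 ≤ (N p : ℝ) ^ (-(3 / 2) : ℝ) := Real.rpow_nonneg (hN0 p).le _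
          by_cases hp : p ∈ d
          · simp only [k, hp, if_true, pow_one]
            have : (N p : ℝ)⁻¹ ^ θ ≤ 1 :=
              Real.rpow_le_one (inv_nonneg.2 (hN0 p).le) (inv_le_one_of_one_le₀ (hN1 p)) hθ
            linarith
          · simp only [k, hp, if_false, one_mul]
            have : (N p ^ h : ℝ)⁻¹ ^ θ ≤ (N p : ℝ) ^ (-(3 / 2) : ℝ) := by
              rw [← Real.rpow_natCast, ← Real.rpow_neg (hN0 p).le, ← Real.rpow_mul (hN0 p).le]
              refine Real.rpow_le_rpow_of_exponent_le (hN1 p) ?_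
              have : (2 : ℝ) ≤ h := by exact_mod_cast hh
              nlinarith [R.le_θ]
            linarith
      _ ≤ 2 ^ d.card * Real.exp B := by
          rw [Finset.prod_mul_distrib, Finset.prod_ite_mem, Finset.inter_eq_right.2 hd,
            Finset.prod_const, ← Real.exp_sum]
          gcongr
          exact (R.summable_prime (by norm_num)).sum_le_tsum _
            fun p _ => Real.rpow_nonneg (hN0 p).le _
  have h3 : (x / D) ^ θ ≤ x ^ θ :=
    Real.rpow_le_rpow (by positivity) (div_le_self hx0.le hD) (by linarith [R.le_θ])
  calc C * (x / D) ^ θ * ∏ p ∈ R.primesBelow x, (1 + (N p ^ k p : ℝ)⁻¹ ^ θ)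
      ≤ C * x ^ θ * (2 ^ d.card * Real.exp B) := by
        have := R.C_nonneg
        gcongr
    _ = _ := by ring

end AbelianMonoid

/-! ### From Bernoulli to Poisson to Gauss, and auxiliary limits. -/

namespace AbelianMonoid

lemma norm_prod_sub_prod_le {α : Type*} (Q : Finset α) {a b : α → ℂ}
    (ha : ∀ p ∈ Q, ‖a p‖ ≤ 1) (hb : ∀ p ∈ Q, ‖b p‖ ≤ 1) :
    ‖∏ p ∈ Q, a p - ∏ p ∈ Q, b p‖ ≤ ∑ p ∈ Q, ‖a p - b p‖ := by
  classical
  induction Q using Finset.induction_on with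
  | empty => simp
  | insert q Q hq ih =>
    simp only [Finset.mem_insert, forall_eq_or_imp] at ha hb
    rw [Finset.prod_insert hq, Finset.prod_insert hq, Finset.sum_insert hq]
    have h : a q * ∏ p ∈ Q, a p - b q * ∏ p ∈ Q, b p
        = (a q - b q) * ∏ p ∈ Q, a p + b q * (∏ p ∈ Q, a p - ∏ p ∈ Q, b p) := by ring
    have h1 : ‖∏ p ∈ Q, a p‖ ≤ 1 := by
      rw [norm_prod]
      exact Finset.prod_le_one (fun _ _ => norm_nonneg _) ha.2
    rw [h]
    refine (norm_add_le _ _).trans (add_le_add ?_ ?_)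
    · rw [norm_mul]
      exact mul_le_of_le_one_right (norm_nonneg _) h1
    · rw [norm_mul]
      exact (mul_le_of_le_one_left (norm_nonneg _) hb.1).trans (ih ha.2 hb.2)

lemma norm_exp_I_mul (τ : ℝ) : ‖Complex.exp (Complex.I * τ)‖ = 1 := by
  rw [mul_comm]; exact Complex.norm_exp_ofReal_mul_I τ

/-- Replacing Bernoulli factors of a characteristic function by Poisson factors. -/
lemma norm_prod_sub_exp_le {α : Type*} (Q : Finset α) {f : α → ℝ}
    (hf : ∀ p ∈ Q, 0 ≤ f p ∧ f p ≤ 1 / 2) {z : ℂ} (hz : ‖1 + z‖ = 1) :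
    ‖∏ p ∈ Q, (1 + z * f p) - Complex.exp (z * (∑ p ∈ Q, f p : ℝ))‖
      ≤ ‖z‖ ^ 2 * ∑ p ∈ Q, f p ^ 2 := by
  have hz2 : ‖z‖ ≤ 2 := by
    have := norm_sub_le (1 + z) 1
    rw [add_sub_cancel_left, hz, norm_one] at this
    linarith
  have hre : z.re ≤ 0 := by
    have := Complex.re_le_norm (1 + z)
    rw [hz, Complex.add_re, Complex.one_re] at this
    linarith
  rw [Complex.ofReal_sum, Finset.mul_sum, Complex.exp_sum, Finset.mul_sum]
  refine (norm_prod_sub_prod_le Q (fun p hp => ?_) fun p hp => ?_).trans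
    (Finset.sum_le_sum fun p hp => ?_)
  · obtain ⟨h0, h1⟩ := hf p hp
    -- A convex combination of the points `1` and `1 + z` of the unit circle.
    have : 1 + z * f p = ((1 - f p : ℝ) : ℂ) + (f p : ℂ) * (1 + z) := by push_cast; ring
    rw [this]
    refine (norm_add_le _ _).trans ?_
    rw [norm_mul, hz, Complex.norm_real, Complex.norm_real, Real.norm_of_nonneg h0,
      Real.norm_of_nonneg (by linarith)]
    linarith
  · obtain ⟨h0, h1⟩ := hf p hp
    rw [Complex.norm_exp, Real.exp_le_one_iff, Complex.re_mul_ofReal]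
    exact mul_nonpos_of_nonpos_of_nonneg hre h0
  · obtain ⟨h0, h1⟩ := hf p hp
    have hn : ‖z * f p‖ = ‖z‖ * f p := by
      rw [norm_mul, Complex.norm_real, Real.norm_of_nonneg h0]
    -- The bound `f p ≤ 1/2` is needed here, because `‖z‖` can be as large as 2.
    have h2 : ‖z * f p‖ ≤ 1 := by
      rw [hn]
      calc ‖z‖ * f p ≤ 2 * (1 / 2) := by gcongr
        _ = 1 := by norm_num
    have := Complex.norm_exp_sub_one_sub_id_le h2
    rw [norm_sub_rev, ← mul_pow, ← hn]
    rwa [sub_sub] at this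

lemma norm_exp_mul_sub_exp_mul_le (τ : ℝ) {a b : ℕ} (hab : b ≤ a) :
    ‖Complex.exp (Complex.I * τ) ^ a - Complex.exp (Complex.I * τ) ^ b‖ ≤ |τ| * (a - b : ℕ) := by
  obtain ⟨k, rfl⟩ := Nat.exists_eq_add_of_le hab
  have h : Complex.exp (Complex.I * τ) ^ k = Complex.exp (Complex.I * (τ * k : ℝ)) := by
    rw [← Complex.exp_nat_mul]
    congr 1
    push_cast
    ring
  rw [pow_add, ← mul_sub_one, norm_mul, norm_pow, norm_exp_I_mul, one_pow, one_mul, h,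
    Nat.add_sub_cancel_left]
  refine Real.norm_exp_I_mul_ofReal_sub_one_le.trans (le_of_eq ?_)
  rw [Real.norm_eq_abs, abs_mul, Nat.abs_cast]

lemma tendsto_log_div_sqrt (a b : ℝ) :
    Tendsto (fun u : ℝ => (a * Real.log u + b) / √u) atTop (𝓝 0) := by
  have h1 : Tendsto (fun u : ℝ => Real.log u / √u) atTop (𝓝 0) := by
    simp only [Real.sqrt_eq_rpow]
    exact (isLittleO_log_rpow_atTop (by norm_num)).tendsto_div_nhds_zero
  have h2 : Tendsto (fun u : ℝ => b / √u) atTop (𝓝 0) :=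
    tendsto_const_nhds.div_atTop Real.tendsto_sqrt_atTop
  have := (h1.const_mul a).add h2
  simp only [mul_zero, add_zero] at this
  refine this.congr fun u => ?_
  ring

/-- A Poisson characteristic function with parameter close to `lam`, after normalization. -/
lemma tendsto_exp_poisson {α : Type*} {l : Filter α} {lam L : α → ℝ} (hlam : Tendsto lam l atTop)
    {B : ℝ} (hL : ∀ᶠ x in l, |L x - lam x| ≤ 2 * Real.log (lam x) + B) (t : ℝ) :
    Tendsto (fun x => Complex.exp ((Complex.exp (Complex.I * (t / √(lam x) : ℝ)) - 1) * L x
      - Complex.I * (t * √(lam x) : ℝ))) l (𝓝 (Complex.exp (-t ^ 2 / 2))) := by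
  refine (Complex.continuous_exp.tendsto _).comp (tendsto_iff_norm_sub_tendsto_zero.2 ?_)
  have hlim : Tendsto (fun x => |t| * ((2 * Real.log (lam x) + B) / √(lam x))
      + |t| ^ 3 * ((0 * Real.log (lam x) + 1) / √(lam x))) l (𝓝 (|t| * 0 + |t| ^ 3 * 0)) :=
    (((tendsto_log_div_sqrt 2 B).comp hlam).const_mul _).add
      (((tendsto_log_div_sqrt 0 1).comp hlam).const_mul _)
  rw [mul_zero, mul_zero, add_zero] at hlim
  refine squeeze_zero' (Eventually.of_forall fun _ => norm_nonneg _) ?_ hlim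
  filter_upwards [hL, hlam.eventually_ge_atTop (max 1 (t ^ 2))] with x hx hge
  set lm := lam x
  have h1 : 1 ≤ lm := (le_max_left _ _).trans hge
  have ht2 : t ^ 2 ≤ lm := (le_max_right _ _).trans hge
  have hlm : 0 < lm := by linarith
  set σ := √lm
  have hσ : 0 < σ := Real.sqrt_pos.2 hlm
  have hσ2 : σ ^ 2 = lm := Real.sq_sqrt hlm.le
  set τ := t / σ
  have hτ1 : |τ| ≤ 1 := by
    rw [abs_div, abs_of_pos hσ, div_le_one hσ]
    exact Real.abs_le_sqrt ht2
  set z := Complex.exp (Complex.I * τ) - 1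
  have hz : ‖z‖ ≤ |τ| := Real.norm_exp_I_mul_ofReal_sub_one_le
  have hn : ‖Complex.I * (τ : ℂ)‖ = |τ| := by simp
  -- Taylor expansion of `exp(iτ)` to second order.
  have hz3 : ‖z - Complex.I * τ + τ ^ 2 / 2‖ ≤ |τ| ^ 3 := by
    have h := Complex.exp_bound (x := Complex.I * τ) (n := 3) (by rwa [hn]) (by norm_num)
    rw [hn] at h
    refine (le_of_eq ?_).trans (h.trans ?_)
    · congr 1
      simp only [z, Finset.sum_range_succ, Finset.sum_range_zero]
      simp only [Nat.factorial]
      push_cast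
      rw [mul_pow _ _ 2, Complex.I_sq]
      ring
    · refine mul_le_of_le_one_right (by positivity) ?_
      norm_num [Nat.factorial]
  have hτσ : t * σ = τ * lm := by
    simp only [τ]; rw [← hσ2]; field_simp
  have htl : t ^ 2 = τ ^ 2 * lm := by
    simp only [τ]; rw [← hσ2]; field_simp
  -- Since `tσ = τ lm` and `t² = τ² lm`, the linear and quadratic Taylor terms cancel. What remains
  -- is of size `|τ| |L - lm| + |τ|³ lm`, with `|τ| = |t| / √lm`.
  have e : z * (L x : ℂ) - Complex.I * ((t * σ : ℝ) : ℂ) - (-(t : ℂ) ^ 2 / 2)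
      = z * ((L x - lm : ℝ) : ℂ) + (z - Complex.I * τ + τ ^ 2 / 2) * (lm : ℝ) := by
    have htl' : (t : ℂ) ^ 2 = τ ^ 2 * (lm : ℝ) := by exact_mod_cast htl
    rw [hτσ, htl']
    push_cast
    ring
  rw [e]
  refine (norm_add_le _ _).trans (add_le_add ?_ ?_)
  · rw [norm_mul, Complex.norm_real, Real.norm_eq_abs]
    calc ‖z‖ * |L x - lm| ≤ |τ| * (2 * Real.log lm + B) := by gcongr
      _ = |t| * ((2 * Real.log lm + B) / σ) := by
        simp only [τ]; rw [abs_div, abs_of_pos hσ]; ring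
  · rw [norm_mul, Complex.norm_real, Real.norm_of_nonneg hlm.le]
    calc ‖z - Complex.I * τ + τ ^ 2 / 2‖ * lm ≤ |τ| ^ 3 * lm := by gcongr
      _ = |t| ^ 3 * ((0 * Real.log lm + 1) / σ) := by
        simp only [τ]; rw [abs_div, abs_of_pos hσ, ← hσ2]; field_simp; ring

lemma tendsto_half_pow_mul_exp (a : ℝ) :
    Tendsto (fun u : ℝ => (1 / 2 : ℝ) ^ ⌈u⌉₊ * Real.exp (a * √u)) atTop (𝓝 0) := by
  have hlog : 0 < Real.log 2 := Real.log_pos one_lt_two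
  have h : Tendsto (fun u : ℝ => Real.exp (-√u)) atTop (𝓝 0) :=
    Real.tendsto_exp_neg_atTop_nhds_zero.comp Real.tendsto_sqrt_atTop
  refine squeeze_zero' (Eventually.of_forall fun _ => by positivity) ?_ h
  filter_upwards [Real.tendsto_sqrt_atTop.eventually_ge_atTop ((a + 1) / Real.log 2),
    eventually_ge_atTop 0] with u hu hu0
  rw [div_le_iff₀ hlog] at hu
  have h1 : (1 / 2 : ℝ) ^ ⌈u⌉₊ ≤ Real.exp (-(u * Real.log 2)) := by
    calc (1 / 2 : ℝ) ^ ⌈u⌉₊ = (1 / 2 : ℝ) ^ (⌈u⌉₊ : ℝ) := (Real.rpow_natCast _ _).symm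
      _ ≤ (1 / 2 : ℝ) ^ u :=
        Real.rpow_le_rpow_of_exponent_ge (by norm_num) (by norm_num) (Nat.le_ceil u)
      _ = _ := by
        rw [Real.rpow_def_of_pos (by norm_num), one_div, Real.log_inv]
        congr 1; ring
  calc (1 / 2 : ℝ) ^ ⌈u⌉₊ * Real.exp (a * √u)
      ≤ Real.exp (-(u * Real.log 2)) * Real.exp (a * √u) := by gcongr
    _ = Real.exp (-(u * Real.log 2) + a * √u) := (Real.exp_add _ _).symm
    _ ≤ Real.exp (-√u) := by
      refine Real.exp_le_exp.2 ?_
      nlinarith [Real.sq_sqrt hu0, Real.sqrt_nonneg u]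

/-- With `u = log log x` this is `x^(-c) (K cut x)^⌈u⌉`. It tends to 0 because `(cut x)^⌈u⌉ ≤
x^(2/u)`, a power of `x` with exponent tending to 0. -/
lemma tendsto_exp_mul_pow {c K : ℝ} (hc : 0 < c) (hK : 1 ≤ K) :
    Tendsto (fun u : ℝ => Real.exp (-(c * Real.exp u)) * (K * Real.exp (Real.exp u / u ^ 2)) ^ ⌈u⌉₊)
      atTop (𝓝 0) := by
  have hK0 : 0 < K := by linarith
  have hlogK : 0 ≤ Real.log K := Real.log_nonneg hK
  have hexp : ∀ᶠ u : ℝ in atTop, (2 * Real.log K + 1) * u ≤ c / 2 * Real.exp u := by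
    have h : Tendsto (fun u : ℝ => (2 * Real.log K + 1) * (u ^ 1 * Real.exp (-u))) atTop
        (𝓝 ((2 * Real.log K + 1) * 0)) :=
      (Real.tendsto_pow_mul_exp_neg_atTop_nhds_zero 1).const_mul _
    rw [mul_zero] at h
    filter_upwards [h.eventually (gt_mem_nhds (half_pos hc))] with u hu
    rw [pow_one, Real.exp_neg, ← mul_assoc, ← div_eq_mul_inv, div_lt_iff₀ (Real.exp_pos u)] at hu
    exact hu.le
  refine squeeze_zero' (Eventually.of_forall fun _ => by positivity) ?_
    Real.tendsto_exp_neg_atTop_nhds_zero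
  filter_upwards [hexp, eventually_ge_atTop 1, eventually_ge_atTop (4 / c)] with u h1 h2 h3
  have hu0 : 0 < u := by linarith
  rw [div_le_iff₀ hc] at h3
  have h4 : (K * Real.exp (Real.exp u / u ^ 2)) ^ ⌈u⌉₊
      = Real.exp (⌈u⌉₊ * (Real.log K + Real.exp u / u ^ 2)) := by
    rw [Real.exp_nat_mul, Real.exp_add, Real.exp_log hK0]
  have h5 : (⌈u⌉₊ : ℝ) ≤ 2 * u := by linarith [Nat.ceil_lt_add_one hu0.le]
  rw [h4, ← Real.exp_add]
  refine Real.exp_le_exp.2 ?_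
  have h6 : ⌈u⌉₊ * (Real.log K + Real.exp u / u ^ 2)
      ≤ 2 * u * (Real.log K + Real.exp u / u ^ 2) := by gcongr
  have h7 : 2 * u * (Real.exp u / u ^ 2) ≤ c / 2 * Real.exp u := by
    have : 2 * u * (Real.exp u / u ^ 2) = 2 / u * Real.exp u := by field_simp
    rw [this]
    refine mul_le_mul_of_nonneg_right ?_ (Real.exp_pos u).le
    rw [div_le_iff₀ hu0]
    linarith
  nlinarith

end AbelianMonoid

/-! ### The characteristic function of the contribution of small generators. -/

namespace AbelianMonoid

/-- The iterated logarithm. -/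
noncomputable def lam (x : ℝ) : ℝ := Real.log (Real.log x)

/-- The bound `x ^ (1 / (log log x) ^ 2)` for the small generators. -/
noncomputable def cut (x : ℝ) : ℝ := Real.exp (Real.log x / lam x ^ 2)

lemma tendsto_lam : Tendsto lam atTop atTop := Real.tendsto_log_atTop.comp Real.tendsto_log_atTop

/-- The last equation explains the exponent in `cut`: discarding the generators above it lowers the
Mertens sum by only `2 log(lam x) + O(1)`, while `(cut x)^(lam x) = x^(1 / lam x)` is still
`x^(o(1))`. -/
lemma eventually_cut : ∀ᶠ x in atTop, 1 ≤ lam x ∧ Real.exp (lam x) = Real.log x ∧ 1 < x ∧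
    Real.exp 1 ≤ x ∧ Real.exp 1 ≤ cut x ∧ cut x ≤ x ∧
    lam (cut x) = lam x - 2 * Real.log (lam x) := by
  have h : ∀ᶠ u : ℝ in atTop, u ^ 2 ≤ Real.exp u := by
    have := (Real.tendsto_pow_mul_exp_neg_atTop_nhds_zero 2).eventually (gt_mem_nhds one_pos)
    filter_upwards [this] with u hu
    rw [Real.exp_neg, ← div_eq_mul_inv, div_lt_one (Real.exp_pos u)] at hu
    exact hu.le
  filter_upwards [tendsto_lam.eventually_ge_atTop 1, tendsto_lam.eventually h,
    Real.tendsto_log_atTop.eventually_ge_atTop 1, eventually_gt_atTop 1] with x h1 h2 h3 h4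
  have hx0 : 0 < x := by linarith
  have hl0 : 0 < Real.log x := by linarith
  have he : Real.exp (lam x) = Real.log x := Real.exp_log hl0
  rw [he] at h2
  have hlam : 0 < lam x := by linarith
  refine ⟨h1, he, h4, (Real.le_log_iff_exp_le hx0).1 h3, ?_, ?_, ?_⟩
  · refine Real.exp_le_exp.2 ?_
    rwa [one_le_div (by positivity)]
  · rw [cut, ← Real.le_log_iff_exp_le hx0]
    exact div_le_self hl0.le (one_le_pow₀ h1)
  · rw [lam, cut, Real.log_exp, Real.log_div hl0.ne' (by positivity), Real.log_pow]
    simp [lam]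

variable {P : Type*} {N : P → ℕ} {Y : Set ℝ} {κ θ C q : ℝ}

lemma Regular.primesBelow_mono (R : Regular N Y κ θ C q) {x y : ℝ} (h : x ≤ y) :
    R.primesBelow x ⊆ R.primesBelow y := fun _ hp =>
  R.mem_primesBelow.2 ((R.mem_primesBelow.1 hp).trans h)

lemma Regular.card_primesBelow_le (R : Regular N Y κ θ C q) (x : ℝ) :
    ((R.primesBelow x).card : ℝ) ≤ cnt N Set.univ x := by
  rw [cnt, Nat.cast_le, ← Set.ncard_coe_finset]
  refine Set.ncard_le_ncard_of_injOn (fun p => Finsupp.single p 1) ?_ ?_ (R.finite x)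
  · intro p hp
    exact ⟨trivial, by simpa [norm_single] using R.mem_primesBelow.1 hp⟩
  · intro p _ p' _ h
    exact Finsupp.single_left_injective one_ne_zero h

/-- The `h`-free elements of norm at most `x`. -/
noncomputable def Regular.hFreeBelow (R : Regular N Y κ θ C q) (h : ℕ) (x : ℝ) :
    Finset (FreeMon P) := (R.finite_below (hFree P h) x).toFinset

lemma Regular.card_hFreeBelow (R : Regular N Y κ θ C q) (h : ℕ) (x : ℝ) :
    ((R.hFreeBelow h x).card : ℝ) = cnt N (hFree P h) x := by
  rw [cnt, hFreeBelow, Set.ncard_eq_toFinset_card _ (R.finite_below (hFree P h) x)]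

lemma Regular.mem_hFreeBelow (R : Regular N Y κ θ C q) {h : ℕ} {x : ℝ} {m : FreeMon P} :
    m ∈ R.hFreeBelow h x ↔ m ∈ hFree P h ∧ (norm N m : ℝ) ≤ x := by
  simp [hFreeBelow, below]

lemma Regular.card_filter_hFreeBelow (R : Regular N Y κ θ C q) (h : ℕ) (d : Finset P) (x : ℝ) :
    (((R.hFreeBelow h x).filter fun m => ∀ p ∈ d, m p = 1).card : ℝ)
      = cnt N (hFreeExact h d) x := by
  rw [cnt, ← Set.ncard_coe_finset]
  congr 2
  ext m
  simp only [Finset.coe_filter, R.mem_hFreeBelow, Set.mem_ofPred_eq, below, hFreeExact]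
  tauto

lemma hFreeExact_empty (h : ℕ) : hFreeExact h (∅ : Finset P) = hFree P h := by
  ext m
  simp [hFreeExact]

/-- The expected number of `h`-free elements of norm at most `x`. -/
noncomputable def Regular.mass (R : Regular N Y κ θ C q) (h : ℕ) (x : ℝ) : ℝ := κ * R.dens h x * x

section

variable [Countable P]

lemma Regular.exists_le_mass (R : Regular N Y κ θ C q) {h : ℕ} (hh : 2 ≤ h) :
    ∃ c, 0 < c ∧ ∀ x, 0 < x → c * x ≤ R.mass h x := by
  obtain ⟨ρ, hρ, hle⟩ := R.exists_le_dens hh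
  have hκ := R.κ_pos
  refine ⟨κ * ρ, by positivity, fun x hx => ?_⟩
  unfold mass
  gcongr
  exact hle x

lemma Regular.tendsto_cnt_div_mass (R : Regular N Y κ θ C q) {h : ℕ} (hh : 2 ≤ h) :
    Tendsto (fun x => cnt N (hFree P h) x / R.mass h x) (atTop ⊓ 𝓟 Y) (𝓝 1) := by
  obtain ⟨G, hG, hcnt⟩ := R.exists_cnt_hFreeExact hh
  obtain ⟨c, hc, hmass⟩ := R.exists_le_mass hh
  have hlim : Tendsto (fun x : ℝ => G / c * x ^ (-(1 - θ))) (atTop ⊓ 𝓟 Y) (𝓝 (G / c * 0)) :=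
    ((tendsto_rpow_neg_atTop (by linarith [R.θ_lt])).const_mul _).mono_left inf_le_left
  rw [mul_zero] at hlim
  refine tendsto_iff_norm_sub_tendsto_zero.2
    (squeeze_zero' (Eventually.of_forall fun _ => norm_nonneg _) ?_ hlim)
  filter_upwards [mem_inf_of_left (Ioi_mem_atTop 0), mem_inf_of_right (mem_principal_self Y)]
    with x hx0 hxY
  rw [Set.mem_Ioi] at hx0
  have hM : 0 < R.mass h x := lt_of_lt_of_le (by positivity) (hmass x hx0)
  have h1 := hcnt x hxY hx0 ∅ (Finset.empty_subset _)
  simp only [hFreeExact_empty, Finset.prod_empty, Finset.card_empty, pow_zero, mul_one] at h1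
  rw [Real.norm_eq_abs, div_sub_one hM.ne', abs_div, abs_of_pos hM, div_le_iff₀ hM]
  refine h1.trans ?_
  have : x ^ θ = x ^ (-(1 - θ)) * x := by
    rw [← Real.rpow_add_one hx0.ne']; congr 1; ring
  calc G * x ^ θ = G / c * x ^ (-(1 - θ)) * (c * x) := by rw [this]; field_simp
    _ ≤ _ := by
      have := hmass x hx0
      have := Real.rpow_nonneg hx0.le (-(1 - θ))
      gcongr

lemma Regular.exists_mertens_cut (R : Regular N Y κ θ C q) :
    ∃ B, 0 ≤ B ∧ ∀ᶠ x in atTop,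
      |∑ p ∈ R.primesBelow (cut x), (N p : ℝ)⁻¹ - lam x| ≤ 2 * Real.log (lam x) + B ∧
      |∑ p ∈ R.primesBelow x, (N p : ℝ)⁻¹ - lam x| ≤ B := by
  obtain ⟨B, hB⟩ := R.exists_mertens
  have hB0 : 0 ≤ B := (abs_nonneg _).trans (hB _ le_rfl)
  refine ⟨B, hB0, ?_⟩
  filter_upwards [eventually_cut] with x ⟨h1, h2, h3, h4, h5, h6, h7⟩
  refine ⟨?_, hB x h4⟩
  have h := hB _ h5
  rw [← lam, h7] at h
  have : 0 ≤ Real.log (lam x) := Real.log_nonneg h1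
  rw [abs_le] at h ⊢
  constructor <;> linarith [h.1, h.2]

lemma Regular.sum_freq_bounds (R : Regular N Y κ θ C q) {h : ℕ} (hh : 2 ≤ h) (Q : Finset P) :
    ∑ p ∈ Q, freq N h p ≤ ∑ p ∈ Q, (N p : ℝ)⁻¹ ∧
    ∑ p ∈ Q, (N p : ℝ)⁻¹ - ∑' p, (N p ^ 2 : ℝ)⁻¹ ≤ ∑ p ∈ Q, freq N h p ∧
    ∑ p ∈ Q, freq N h p ^ 2 ≤ ∑' p, (N p ^ 2 : ℝ)⁻¹ := by
  have hsum : ∑ p ∈ Q, (N p ^ 2 : ℝ)⁻¹ ≤ ∑' p, (N p ^ 2 : ℝ)⁻¹ :=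
    R.summable_inv_sq.sum_le_tsum _ fun p _ => by positivity
  refine ⟨Finset.sum_le_sum fun p _ => (freq_bounds R.one_lt hh p).2.1, ?_, ?_⟩
  · have : ∑ p ∈ Q, ((N p : ℝ)⁻¹ - (N p ^ 2 : ℝ)⁻¹) ≤ ∑ p ∈ Q, freq N h p :=
      Finset.sum_le_sum fun p _ => (freq_bounds R.one_lt hh p).2.2
    rw [Finset.sum_sub_distrib] at this
    linarith
  · refine (Finset.sum_le_sum fun p _ => ?_).trans hsum
    obtain ⟨h0, h1, -⟩ := freq_bounds R.one_lt hh p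
    rw [← inv_pow]
    gcongr

/-- The number of generators of norm at most `y` which occur in `m` with multiplicity one. -/
noncomputable def Regular.omegaCut (R : Regular N Y κ θ C q) (y : ℝ) (m : FreeMon P) : ℕ :=
  ((R.primesBelow y).filter fun p => m p = 1).card

/-- Truncate the inclusion-exclusion at `r = ⌈lam x⌉`. The sieve errors total `x^θ` times `(O(cut
x))^r`, which is `o(x)`. The tail is `2^(-r) exp(O(√(lam x)))`, because `‖z‖ ≤ |t| / √(lam x)` while
the frequencies sum to at most `2 lam x`. -/
lemma Regular.tendsto_sum_exp_sub_prod (R : Regular N Y κ θ C q) {h : ℕ} (hh : 2 ≤ h) (t : ℝ) :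
    Tendsto (fun x => ‖∑ m ∈ R.hFreeBelow h x,
        Complex.exp (Complex.I * (t / √(lam x) : ℝ)) ^ R.omegaCut (cut x) m
      - R.mass h x * ∏ p ∈ R.primesBelow (cut x),
          (1 + (Complex.exp (Complex.I * (t / √(lam x) : ℝ)) - 1) * freq N h p)‖ / R.mass h x)
      (atTop ⊓ 𝓟 Y) (𝓝 0) := by
  classical
  obtain ⟨G, hG, hcnt⟩ := R.exists_cnt_hFreeExact hh
  obtain ⟨c, hc, hmass⟩ := R.exists_le_mass hh
  obtain ⟨K, hK, hKle⟩ := R.exists_cnt_le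
  obtain ⟨B, hB0, hB⟩ := R.exists_mertens_cut
  have hlim : Tendsto (fun x => G / c * (Real.exp (-((1 - θ) * Real.exp (lam x)))
      * ((4 * K + 2) * Real.exp (Real.exp (lam x) / lam x ^ 2)) ^ ⌈lam x⌉₊)
      + 2 * ((1 / 2 : ℝ) ^ ⌈lam x⌉₊ * Real.exp (4 * |t| * √(lam x)))) (atTop ⊓ 𝓟 Y)
      (𝓝 (G / c * 0 + 2 * 0)) := by
    refine Tendsto.mono_left ?_ inf_le_left
    exact (((tendsto_exp_mul_pow (by linarith [R.θ_lt]) (by linarith)).comp tendsto_lam).const_mul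
      _).add (((tendsto_half_pow_mul_exp _).comp tendsto_lam).const_mul _)
  rw [mul_zero, mul_zero, add_zero] at hlim
  refine squeeze_zero' ?_ ?_ hlim
  · filter_upwards [mem_inf_of_left (Ioi_mem_atTop 0)] with x hx0
    exact div_nonneg (norm_nonneg _)
      (le_trans (mul_nonneg hc.le (le_of_lt hx0)) (hmass x hx0))
  filter_upwards [mem_inf_of_left eventually_cut, mem_inf_of_left hB,
    mem_inf_of_left (tendsto_lam.eventually_ge_atTop B),
    mem_inf_of_right (mem_principal_self Y)] with x ⟨h1, h2, h3, h4, h5, h6, h7⟩ hBx hlB hxY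
  have hx0 : 0 < x := by linarith
  have hM : 0 < R.mass h x := lt_of_lt_of_le (by positivity) (hmass x hx0)
  have hlam : 0 < lam x := by linarith
  set r := ⌈lam x⌉₊
  set Q := R.primesBelow (cut x)
  set z := Complex.exp (Complex.I * (t / √(lam x) : ℝ)) - 1
  have hQ : Q ⊆ R.primesBelow x := R.primesBelow_mono h6
  have hz1 : 1 + z = Complex.exp (Complex.I * (t / √(lam x) : ℝ)) := by simp [z]
  have hz : ‖1 + z‖ = 1 := by rw [hz1, norm_exp_I_mul]
  have hzt : ‖z‖ ≤ |t| / √(lam x) := by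
    refine Real.norm_exp_I_mul_ofReal_sub_one_le.trans (le_of_eq ?_)
    rw [Real.norm_eq_abs, abs_div, abs_of_nonneg (Real.sqrt_nonneg _)]
  have hz2 : ‖z‖ ≤ 2 := by
    have := norm_sub_le (1 + z) 1
    rw [add_sub_cancel_left, hz, norm_one] at this
    linarith
  have hxθ : 0 ≤ x ^ θ := Real.rpow_nonneg hx0.le _
  have key := norm_sum_pow_sub_prod_le (R.hFreeBelow h x) Q (fun m p => m p = 1)
    (f := freq N h) (fun p _ => (freq_bounds R.one_lt hh p).1) (M := R.mass h x)
    (E := G * x ^ θ * 2 ^ r) (r := r) hM.le (by positivity)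
    (fun d hd hdr => by
      rw [R.card_filter_hFreeBelow]
      refine (hcnt x hxY hx0 d (hd.trans hQ)).trans ?_
      gcongr
      norm_num) (z := z) hz.le hz2
  rw [← hz1]
  refine (div_le_div_of_nonneg_right key hM.le).trans ?_
  rw [add_div]
  refine add_le_add ?_ ?_
  · rw [div_le_iff₀ hM]
    have hcard : (2 * Q.card + 1 : ℝ) ≤ (2 * K + 1) * cut x := by
      have h8 := (R.card_primesBelow_le (cut x)).trans (hKle _ (Real.exp_pos _))
      have h9 : 1 ≤ cut x := (Real.one_le_exp zero_le_one).trans h5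
      linarith
    have hxpow : x ^ θ = Real.exp (-((1 - θ) * Real.exp (lam x))) * x := by
      rw [h2]
      nth_rewrite 3 [← Real.exp_log hx0]
      rw [Real.rpow_def_of_pos hx0, ← Real.exp_add]
      congr 1
      ring
    have hcut : Real.exp (Real.exp (lam x) / lam x ^ 2) = cut x := by rw [h2, cut]
    rw [hcut]
    calc G * x ^ θ * 2 ^ r * (2 * Q.card + 1) ^ r
        ≤ G * x ^ θ * 2 ^ r * ((2 * K + 1) * cut x) ^ r := by
          refine mul_le_mul_of_nonneg_left (pow_le_pow_left₀ ?_ hcard r) (by positivity)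
          exact add_nonneg (mul_nonneg two_pos.le (Nat.cast_nonneg _)) one_pos.le
      _ = G * x ^ θ * ((4 * K + 2) * cut x) ^ r := by
          rw [mul_assoc, ← mul_pow]; congr 2; ring
      _ = G / c * (Real.exp (-((1 - θ) * Real.exp (lam x))) * ((4 * K + 2) * cut x) ^ r)
          * (c * x) := by rw [hxpow]; field_simp
      _ ≤ _ := by
          have hcpos : 0 < cut x := Real.exp_pos _
          exact mul_le_mul_of_nonneg_left (hmass x hx0) (by positivity)
  · have hL : ∑ p ∈ Q, freq N h p ≤ 2 * lam x := by
      have h8 := (R.sum_freq_bounds hh (R.primesBelow x)).1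
      have h9 : ∑ p ∈ Q, freq N h p ≤ ∑ p ∈ R.primesBelow x, freq N h p :=
        Finset.sum_le_sum_of_subset_of_nonneg hQ fun p _ _ => (freq_bounds R.one_lt hh p).1
      have := (abs_le.1 hBx.2).2
      linarith
    have hL0 : 0 ≤ ∑ p ∈ Q, freq N h p :=
      Finset.sum_nonneg fun p _ => (freq_bounds R.one_lt hh p).1
    have hzL : 2 * ‖z‖ * ∑ p ∈ Q, freq N h p ≤ 4 * |t| * √(lam x) := by
      calc 2 * ‖z‖ * ∑ p ∈ Q, freq N h p ≤ 2 * (|t| / √(lam x)) * (2 * lam x) := by gcongr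
        _ = 4 * |t| * √(lam x) := by
          have hs := Real.sqrt_pos.2 hlam
          nth_rewrite 2 [← Real.sq_sqrt hlam.le]
          field_simp
          ring
    rw [mul_right_comm, mul_div_assoc, div_self hM.ne', mul_one]
    gcongr

end

end AbelianMonoid

/-! ### Large generators, and the characteristic function of `ω₁`. -/

namespace AbelianMonoid

variable {P : Type*} {N : P → ℕ} {Y : Set ℝ} {κ θ C q : ℝ}

lemma Regular.omegaOne_eq_omegaCut (R : Regular N Y κ θ C q) {x : ℝ} {m : FreeMon P}
    (hm : (norm N m : ℝ) ≤ x) : omegaOne m = R.omegaCut x m := by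
  unfold omegaOne omegaCut
  congr 1
  ext p
  simp only [Finset.mem_filter, Finsupp.mem_support_iff, R.mem_primesBelow]
  refine and_congr_left fun h1 => ?_
  simp only [h1, ne_eq, one_ne_zero, not_false_eq_true, true_iff]
  have := single_le_norm R.one_lt (p := p) (m := m) (k := 1) h1.ge
  rw [pow_one] at this
  exact le_trans (by exact_mod_cast this) hm

/-- A first moment bound: at most `K x / N(p)` elements contain a given `p` exactly once, and these
are summed over `y < N(p) ≤ x`. -/
lemma Regular.sum_omegaOne_sub_le (R : Regular N Y κ θ C q) {h : ℕ} (hh : 2 ≤ h) {K : ℝ}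
    (hK : ∀ x, 0 < x → cnt N Set.univ x ≤ K * x) {x y : ℝ} (hx : 0 < x) (hyx : y ≤ x) :
    ∑ m ∈ R.hFreeBelow h x, ((omegaOne m - R.omegaCut y m : ℕ) : ℝ)
      ≤ K * x * (∑ p ∈ R.primesBelow x, (N p : ℝ)⁻¹ - ∑ p ∈ R.primesBelow y, (N p : ℝ)⁻¹) := by
  classical
  have hsub := R.primesBelow_mono hyx
  have h1 : ∀ m ∈ R.hFreeBelow h x, ((omegaOne m - R.omegaCut y m : ℕ) : ℝ)
      = ∑ p ∈ R.primesBelow x \ R.primesBelow y, if m p = 1 then (1 : ℝ) else 0 := by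
    intro m hm
    rw [R.omegaOne_eq_omegaCut (R.mem_hFreeBelow.1 hm).2, omegaCut, omegaCut,
      ← Finset.card_sdiff_of_subset (Finset.filter_subset_filter _ hsub), ← Finset.sum_filter,
      Finset.sum_const, nsmul_one]
    congr 2
    ext p
    simp only [Finset.mem_sdiff, Finset.mem_filter]
    tauto
  have h2 : ∀ p ∈ R.primesBelow x \ R.primesBelow y,
      (∑ m ∈ R.hFreeBelow h x, if m p = 1 then (1 : ℝ) else 0) ≤ K * x * (N p : ℝ)⁻¹ := by
    intro p hp
    have hpx := (Finset.mem_sdiff.1 hp).1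
    have hNp : (0 : ℝ) < N p := by exact_mod_cast zero_lt_one.trans (R.one_lt p)
    have e : (∑ m ∈ R.hFreeBelow h x, if m p = 1 then (1 : ℝ) else 0)
        = cnt N (hFreeExact h {p}) x := by
      rw [← R.card_filter_hFreeBelow, ← Finset.sum_filter, Finset.sum_const, nsmul_one]
      simp
    rw [e, (R.cnt_hFreeExact hh {p} x).resolve_right (by simpa using hpx), Finset.prod_singleton]
    refine (R.cnt_mono (Set.subset_univ _) le_rfl).trans ((hK _ (by positivity)).trans
      (le_of_eq ?_))
    rw [div_eq_mul_inv, mul_assoc]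
  rw [Finset.sum_congr rfl h1, Finset.sum_comm]
  refine (Finset.sum_le_sum h2).trans (le_of_eq ?_)
  rw [← Finset.mul_sum, Finset.sum_sdiff_eq_sub hsub]

lemma Regular.omegaCut_le (R : Regular N Y κ θ C q) {x y : ℝ} (hyx : y ≤ x) {m : FreeMon P}
    (hm : (norm N m : ℝ) ≤ x) : R.omegaCut y m ≤ omegaOne m := by
  rw [R.omegaOne_eq_omegaCut hm]
  exact Finset.card_le_card (Finset.filter_subset_filter _ (R.primesBelow_mono hyx))

variable [Countable P]

/-- Large generators shift the count by `O(log(lam x))` on average, while the frequency `t / √(lam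
x)` multiplies this shift. -/
lemma Regular.tendsto_sum_exp_sub_sum_exp (R : Regular N Y κ θ C q) {h : ℕ} (hh : 2 ≤ h) (t : ℝ) :
    Tendsto (fun x => ‖∑ m ∈ R.hFreeBelow h x,
        Complex.exp (Complex.I * (t / √(lam x) : ℝ)) ^ omegaOne m
      - ∑ m ∈ R.hFreeBelow h x,
        Complex.exp (Complex.I * (t / √(lam x) : ℝ)) ^ R.omegaCut (cut x) m‖ / R.mass h x)
      (atTop ⊓ 𝓟 Y) (𝓝 0) := by
  obtain ⟨c, hc, hmass⟩ := R.exists_le_mass hh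
  obtain ⟨K, hK, hKle⟩ := R.exists_cnt_le
  obtain ⟨B, hB0, hB⟩ := R.exists_mertens_cut
  have hlim : Tendsto (fun x => |t| * K / c * ((2 * Real.log (lam x) + 2 * B) / √(lam x)))
      (atTop ⊓ 𝓟 Y) (𝓝 (|t| * K / c * 0)) :=
    (((tendsto_log_div_sqrt 2 (2 * B)).comp tendsto_lam).const_mul _).mono_left inf_le_left
  rw [mul_zero] at hlim
  refine squeeze_zero' ?_ ?_ hlim
  · filter_upwards [mem_inf_of_left (Ioi_mem_atTop 0)] with x hx0
    exact div_nonneg (norm_nonneg _)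
      (le_trans (mul_nonneg hc.le (le_of_lt hx0)) (hmass x hx0))
  filter_upwards [mem_inf_of_left eventually_cut, mem_inf_of_left hB] with x
    ⟨h1, h2, h3, h4, h5, h6, h7⟩ hBx
  have hx0 : 0 < x := by linarith
  have hM : 0 < R.mass h x := lt_of_lt_of_le (by positivity) (hmass x hx0)
  have hσ : 0 < √(lam x) := Real.sqrt_pos.2 (by linarith)
  have hlog : 0 ≤ Real.log (lam x) := Real.log_nonneg h1
  rw [div_le_iff₀ hM, ← Finset.sum_sub_distrib]
  calc _ ≤ ∑ m ∈ R.hFreeBelow h x, |t / √(lam x)| * ((omegaOne m - R.omegaCut (cut x) m : ℕ) : ℝ) :=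
        norm_sum_le_of_le _ fun m hm =>
          norm_exp_mul_sub_exp_mul_le _ (R.omegaCut_le h6 (R.mem_hFreeBelow.1 hm).2)
    _ ≤ |t / √(lam x)| * (K * x * (∑ p ∈ R.primesBelow x, (N p : ℝ)⁻¹
          - ∑ p ∈ R.primesBelow (cut x), (N p : ℝ)⁻¹)) := by
        rw [← Finset.mul_sum]
        exact mul_le_mul_of_nonneg_left (R.sum_omegaOne_sub_le hh hKle hx0 h6) (abs_nonneg _)
    _ ≤ |t / √(lam x)| * (K * x * (2 * Real.log (lam x) + 2 * B)) := by
        gcongr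
        linarith [(abs_le.1 hBx.1).1, (abs_le.1 hBx.2).2]
    _ = |t| * K / c * ((2 * Real.log (lam x) + 2 * B) / √(lam x)) * (c * x) := by
        rw [abs_div, abs_of_pos hσ]
        field_simp
    _ ≤ _ := by
        gcongr
        exact hmass x hx0

/-- The characteristic functions of the normalized `ω₁` on the `h`-free elements. -/
lemma Regular.tendsto_charSum (R : Regular N Y κ θ C q) {h : ℕ} (hh : 2 ≤ h) (t : ℝ) :
    Tendsto (fun x => ((R.hFreeBelow h x).card : ℂ)⁻¹ * ∑ m ∈ R.hFreeBelow h x,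
        Complex.exp (t * ((omegaOne m - lam x) / √(lam x) : ℝ) * Complex.I))
      (atTop ⊓ 𝓟 Y) (𝓝 (Complex.exp (-t ^ 2 / 2))) := by
  obtain ⟨c, hc, hmass⟩ := R.exists_le_mass hh
  obtain ⟨B, hB0, hB⟩ := R.exists_mertens_cut
  set B₂ := ∑' p, (N p ^ 2 : ℝ)⁻¹
  set z : ℝ → ℂ := fun x => Complex.exp (Complex.I * (t / √(lam x) : ℝ)) - 1
  set L : ℝ → ℝ := fun x => ∑ p ∈ R.primesBelow (cut x), freq N h p
  set W : ℝ → ℂ := fun x => ∑ m ∈ R.hFreeBelow h x,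
    Complex.exp (Complex.I * (t / √(lam x) : ℝ)) ^ omegaOne m
  set A : ℝ → ℂ := fun x => ∑ m ∈ R.hFreeBelow h x,
    Complex.exp (Complex.I * (t / √(lam x) : ℝ)) ^ R.omegaCut (cut x) m
  set Pr : ℝ → ℂ := fun x => ∏ p ∈ R.primesBelow (cut x), (1 + z x * freq N h p)
  set e : ℝ → ℂ := fun x => Complex.exp (-(Complex.I * (t * √(lam x) : ℝ)))
  have hlamF : Tendsto lam (atTop ⊓ 𝓟 Y) atTop := tendsto_lam.mono_left inf_le_left
  have l1 : Tendsto (fun x => ‖W x - A x‖ / R.mass h x) (atTop ⊓ 𝓟 Y) (𝓝 0) :=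
    R.tendsto_sum_exp_sub_sum_exp hh t
  have l2 : Tendsto (fun x => ‖A x - R.mass h x * Pr x‖ / R.mass h x) (atTop ⊓ 𝓟 Y) (𝓝 0) :=
    R.tendsto_sum_exp_sub_prod hh t
  have l3 : Tendsto (fun x => ‖Pr x - Complex.exp (z x * L x)‖) (atTop ⊓ 𝓟 Y) (𝓝 0) := by
    have hlim : Tendsto (fun x => t ^ 2 * B₂ / lam x) (atTop ⊓ 𝓟 Y) (𝓝 0) :=
      tendsto_const_nhds.div_atTop hlamF
    refine squeeze_zero' (Eventually.of_forall fun _ => norm_nonneg _) ?_ hlim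
    filter_upwards [hlamF.eventually_gt_atTop 0] with x hx
    have hz : ‖1 + z x‖ = 1 := by
      simp only [z]; rw [add_sub_cancel, norm_exp_I_mul]
    refine (norm_prod_sub_exp_le _ (fun p _ => ⟨(freq_bounds R.one_lt hh p).1,
      (freq_bounds R.one_lt hh p).2.1.trans (inv_le_half R.one_lt p)⟩) hz).trans ?_
    have hz2 : ‖z x‖ ^ 2 ≤ t ^ 2 / lam x := by
      have := Real.norm_exp_I_mul_ofReal_sub_one_le (x := t / √(lam x))
      calc ‖z x‖ ^ 2 ≤ ‖t / √(lam x)‖ ^ 2 := by gcongr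
        _ = t ^ 2 / lam x := by
          rw [Real.norm_eq_abs, sq_abs, div_pow, Real.sq_sqrt hx.le]
    calc _ ≤ t ^ 2 / lam x * B₂ :=
          mul_le_mul hz2 (R.sum_freq_bounds hh _).2.2
            (Finset.sum_nonneg fun p _ => sq_nonneg _) (by positivity)
      _ = _ := by ring
  have l4 : Tendsto (fun x => Complex.exp (z x * L x - Complex.I * (t * √(lam x) : ℝ)))
      (atTop ⊓ 𝓟 Y) (𝓝 (Complex.exp (-t ^ 2 / 2))) := by
    refine tendsto_exp_poisson hlamF (B := B + B₂) ?_ t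
    filter_upwards [mem_inf_of_left hB] with x hx
    have hs := R.sum_freq_bounds hh (R.primesBelow (cut x))
    have hB₂ : 0 ≤ B₂ := tsum_nonneg fun p => by positivity
    have h1 := abs_le.1 hx.1
    rw [abs_le]
    constructor <;> linarith [hs.1, hs.2.1, h1.1, h1.2]
  -- The three errors are the large generators (`l1`), the failure of independence (`l2`) and the
  -- passage from Bernoulli to Poisson (`l3`). The factor `e x` has modulus 1 and only recenters.
  have l5 : Tendsto (fun x => e x * W x / R.mass h x) (atTop ⊓ 𝓟 Y)
      (𝓝 (Complex.exp (-t ^ 2 / 2))) := by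
    refine tendsto_of_tendsto_of_dist l4 ?_
    have hlim := (l1.add l2).add l3
    rw [add_zero, add_zero] at hlim
    refine squeeze_zero' (Eventually.of_forall fun _ => dist_nonneg) ?_ hlim
    filter_upwards [mem_inf_of_left (Ioi_mem_atTop 0)] with x hx0
    have hM : 0 < R.mass h x := lt_of_lt_of_le (mul_pos hc hx0) (hmass x hx0)
    have hMc : (R.mass h x : ℂ) ≠ 0 := Complex.ofReal_ne_zero.2 hM.ne'
    have he : ‖e x‖ = 1 := by
      have := norm_exp_I_mul (-(t * √(lam x)))
      rwa [Complex.ofReal_neg, mul_neg] at this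
    have hE : Complex.exp (z x * L x - Complex.I * (t * √(lam x) : ℝ))
        = e x * Complex.exp (z x * L x) := by
      rw [← Complex.exp_add]; congr 1; ring
    have hdecomp : e x * W x / R.mass h x - e x * Complex.exp (z x * L x)
        = e x * ((W x - A x) / R.mass h x + (A x - R.mass h x * Pr x) / R.mass h x
          + (Pr x - Complex.exp (z x * L x))) := by
      field_simp
      ring
    rw [dist_comm, dist_eq_norm, hE, hdecomp, norm_mul, he, one_mul]
    refine (norm_add_le _ _).trans (add_le_add ((norm_add_le _ _).trans (le_of_eq ?_)) le_rfl)
    rw [norm_div, norm_div, Complex.norm_real, Real.norm_of_nonneg hM.le]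
  have l6 : Tendsto (fun x => ((R.hFreeBelow h x).card : ℂ) / R.mass h x) (atTop ⊓ 𝓟 Y) (𝓝 1) := by
    have := (Complex.continuous_ofReal.tendsto 1).comp (R.tendsto_cnt_div_mass hh)
    rw [Complex.ofReal_one] at this
    refine this.congr fun x => ?_
    simp [← R.card_hFreeBelow]
  -- Replaces the expected number of `h`-free elements by the actual one.
  have l7 := l5.div l6 one_ne_zero
  rw [div_one] at l7
  refine l7.congr' ?_
  filter_upwards [mem_inf_of_left (Ioi_mem_atTop 0), hlamF.eventually_gt_atTop 0] with x hx0 hlam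
  have hM : 0 < R.mass h x := lt_of_lt_of_le (mul_pos hc hx0) (hmass x hx0)
  have hMc : (R.mass h x : ℂ) ≠ 0 := Complex.ofReal_ne_zero.2 hM.ne'
  simp only [Pi.div_apply]
  rw [div_div_div_cancel_right₀ hMc, div_eq_inv_mul, Finset.mul_sum]
  congr 1
  refine Finset.sum_congr rfl fun m _ => ?_
  rw [← Complex.exp_nat_mul, ← Complex.exp_add]
  congr 1
  have hσ : 0 < √(lam x) := Real.sqrt_pos.2 hlam
  have h1 : t * ((omegaOne m - lam x) / √(lam x)) = omegaOne m * (t / √(lam x)) - t * √(lam x) := by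
    nth_rewrite 1 [← Real.sq_sqrt hlam.le]
    field_simp
  rw [← Complex.ofReal_mul, h1]
  push_cast
  ring

end AbelianMonoid

/-! ### From characteristic functions to distribution functions. -/

namespace AbelianMonoid

open MeasureTheory ProbabilityTheory in
lemma gaussPhi_eq_real (a : ℝ) : gaussPhi a = (gaussianReal 0 1).real (Set.Iic a) := by
  rw [measureReal_def, gaussianReal_apply_eq_integral 0 one_ne_zero, ENNReal.toReal_ofReal
    (integral_nonneg fun x => gaussianPDFReal_nonneg _ _ _), gaussPhi, ← integral_const_mul]
  simp [gaussianPDFReal]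

lemma continuous_gaussPhi : Continuous gaussPhi := by
  have hint : MeasureTheory.Integrable fun u : ℝ => Real.exp (-u ^ 2 / 2) := by
    have := integrable_exp_neg_mul_sq (b := 1 / 2) (by norm_num)
    refine this.congr (Eventually.of_forall fun u => ?_)
    show Real.exp _ = Real.exp _
    congr 1
    ring
  have h : gaussPhi = fun a => 1 / Real.sqrt (2 * Real.pi) *
      ((∫ u in Set.Iic (0 : ℝ), Real.exp (-u ^ 2 / 2)) + ∫ u in (0 : ℝ)..a, Real.exp (-u ^ 2 / 2)) := by
    funext a
    rw [gaussPhi, ← intervalIntegral.integral_Iic_sub_Iic hint.integrableOn hint.integrableOn]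
    ring
  rw [h]
  exact continuous_const.mul (continuous_const.add
    (intervalIntegral.continuous_primitive (fun a b => hint.intervalIntegrable) 0))

/-- The uniform distribution on the values of `g` on a finite set. -/
noncomputable def empirical {ι : Type*} (S : Finset ι) (g : ι → ℝ) : MeasureTheory.Measure ℝ :=
  ∑ m ∈ S, (S.card : ENNReal)⁻¹ • MeasureTheory.Measure.dirac (g m)

lemma isProbabilityMeasure_empirical {ι : Type*} {S : Finset ι} (hS : S.Nonempty) (g : ι → ℝ) :
    MeasureTheory.IsProbabilityMeasure (empirical S g) := by
  refine ⟨?_⟩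
  have : (S.card : ENNReal) ≠ 0 := by simpa using hS.ne_empty
  simp [empirical, ENNReal.mul_inv_cancel this]

open Classical in
lemma empirical_real {ι : Type*} (S : Finset ι) (g : ι → ℝ) {E : Set ℝ} (hE : MeasurableSet E) :
    (empirical S g).real E = (S.filter fun m => g m ∈ E).card / S.card := by
  simp only [MeasureTheory.measureReal_def, empirical, MeasureTheory.Measure.coe_finsetSum,
    Finset.sum_apply, MeasureTheory.Measure.smul_apply, MeasureTheory.Measure.dirac_apply' _ hE,
    smul_eq_mul]
  rw [← Finset.mul_sum, ENNReal.toReal_mul, div_eq_inv_mul, ENNReal.toReal_inv,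
    ENNReal.toReal_natCast]
  congr 1
  simp only [Set.indicator_apply, Pi.one_apply]
  rw [← Finset.sum_filter, Finset.sum_const, nsmul_one, ENNReal.toReal_natCast]

open MeasureTheory in
lemma charFun_empirical {ι : Type*} (S : Finset ι) (g : ι → ℝ) (t : ℝ) :
    charFun (empirical S g) t
      = (S.card : ℂ)⁻¹ * ∑ m ∈ S, Complex.exp (t * (g m : ℝ) * Complex.I) := by
  rcases S.eq_empty_or_nonempty with rfl | hS
  · simp [empirical]
  have hc : (S.card : ENNReal)⁻¹ ≠ ⊤ := by simpa using hS.ne_empty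
  rw [charFun_apply_real, empirical, integral_finsetSum_measure, Finset.mul_sum]
  · refine Finset.sum_congr rfl fun m _ => ?_
    rw [integral_smul_measure, integral_dirac, ENNReal.toReal_inv, ENNReal.toReal_natCast]
    simp
  · intro m _
    exact Integrable.smul_measure (integrable_dirac (by finiteness)) hc

open MeasureTheory ProbabilityTheory in
/-- The **Lévy continuity theorem** for uniform distributions on finite sets. -/
lemma tendsto_card_filter_of_charFun {ι α : Type*} {l : Filter α} [l.IsCountablyGenerated]
    {S : α → Finset ι} {g : α → ι → ℝ} (hS : ∀ᶠ x in l, (S x).Nonempty)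
    (h : ∀ t : ℝ, Tendsto (fun x => ((S x).card : ℂ)⁻¹ *
      ∑ m ∈ S x, Complex.exp (t * (g x m : ℝ) * Complex.I)) l (𝓝 (Complex.exp (-t ^ 2 / 2))))
    (a : ℝ) :
    Tendsto (fun x => (((S x).filter fun m => g x m ≤ a).card : ℝ) / (S x).card) l
      (𝓝 (gaussPhi a)) := by
  classical
  -- The continuity theorem is applied along sequences, which suffices for a countably generated
  -- filter.
  refine tendsto_of_seq_tendsto fun u hu => ?_
  set ν : ℕ → Measure ℝ := fun n =>
    -- The Dirac mass is a default value that makes every `ν n` a probability measure; it is used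
    -- for only finitely many `n`.
    if (S (u n)).Nonempty then empirical (S (u n)) (g (u n)) else Measure.dirac 0
  have hν : ∀ n, IsProbabilityMeasure (ν n) := by
    intro n
    simp only [ν]
    split_ifs with hn
    · exact isProbabilityMeasure_empirical hn _
    · infer_instance
  set μ : ℕ → ProbabilityMeasure ℝ := fun n => ⟨ν n, hν n⟩
  set μ₀ : ProbabilityMeasure ℝ := ⟨gaussianReal 0 1, inferInstance⟩
  have hne : ∀ᶠ n in atTop, (S (u n)).Nonempty := hu.eventually hS
  have hlim : Tendsto μ atTop (𝓝 μ₀) := by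
    refine ProbabilityMeasure.tendsto_of_tendsto_charFun fun t => ?_
    have h0 : charFun (μ₀ : Measure ℝ) t = Complex.exp (-t ^ 2 / 2) := by
      change charFun (gaussianReal 0 1) t = _
      rw [charFun_gaussianReal]
      congr 1
      simp
      ring
    rw [h0]
    refine ((h t).comp hu).congr' ?_
    filter_upwards [hne] with n hn
    change _ = charFun (ν n) t
    simp only [ν, if_pos hn, Function.comp]
    rw [charFun_empirical]
  have hnull : NullSingletonClass (gaussianReal 0 1) := nullSingletonClass_gaussianReal one_ne_zero
  -- Convergence in law gives convergence on `Iic a` because the Gaussian does not charge the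
  -- boundary point `a`.
  have hfront : (μ₀ : Measure ℝ) (frontier (Set.Iic a)) = 0 := by
    rw [frontier_Iic]
    change gaussianReal 0 1 {a} = 0
    exact measure_singleton a
  have key := ProbabilityMeasure.tendsto_measure_of_null_frontier_of_tendsto' hlim hfront
  have key' := (ENNReal.tendsto_toReal (measure_ne_top (μ₀ : Measure ℝ) _)).comp key
  rw [gaussPhi_eq_real]
  refine key'.congr' ?_
  filter_upwards [hne] with n hn
  change (ν n).real (Set.Iic a) = _
  simp only [ν, if_pos hn]
  rw [empirical_real _ _ measurableSet_Iic]
  simp only [Set.mem_Iic]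
  congr!

variable {P : Type*} {N : P → ℕ} {Y : Set ℝ} {κ θ C q : ℝ}

lemma Regular.hFreeBelow_nonempty (R : Regular N Y κ θ C q) {h : ℕ} {x : ℝ} (hx : 1 ≤ x) :
    (R.hFreeBelow h x).Nonempty :=
  ⟨0, R.mem_hFreeBelow.2 ⟨by simp [hFree], by simpa [norm_zero] using hx⟩⟩

open Classical in
/-- Central limit theorem for `ω₁`, normalized by the bound for the norm. -/
lemma Regular.tendsto_card_filter_lam [Countable P] (R : Regular N Y κ θ C q) {h : ℕ} (hh : 2 ≤ h)
    (a : ℝ) :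
    Tendsto (fun x => (((R.hFreeBelow h x).filter fun m =>
      (omegaOne m - lam x) / √(lam x) ≤ a).card : ℝ) / (R.hFreeBelow h x).card)
      (atTop ⊓ 𝓟 Y) (𝓝 (gaussPhi a)) := by
  have := tendsto_card_filter_of_charFun (l := atTop ⊓ 𝓟 Y) (S := R.hFreeBelow h)
    (g := fun x m => (omegaOne m - lam x) / √(lam x))
    (mem_inf_of_left ((eventually_ge_atTop 1).mono fun x hx => R.hFreeBelow_nonempty hx))
    (R.tendsto_charSum hh) a
  convert this using 5

/-- The elements of small norm are negligible. -/
lemma Regular.tendsto_small [Countable P] (R : Regular N Y κ θ C q) {h : ℕ} (hh : 2 ≤ h) :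
    Tendsto (fun x => cnt N Set.univ √x / (R.hFreeBelow h x).card) (atTop ⊓ 𝓟 Y) (𝓝 0) := by
  obtain ⟨c, hc, hmass⟩ := R.exists_le_mass hh
  obtain ⟨K, hK, hKle⟩ := R.exists_cnt_le
  have h1 : Tendsto (fun x => cnt N Set.univ √x / R.mass h x) (atTop ⊓ 𝓟 Y) (𝓝 0) := by
    have hlim : Tendsto (fun x : ℝ => K / c / √x) (atTop ⊓ 𝓟 Y) (𝓝 0) :=
      (tendsto_const_nhds.div_atTop Real.tendsto_sqrt_atTop).mono_left inf_le_left
    refine squeeze_zero' ?_ ?_ hlim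
    · filter_upwards [mem_inf_of_left (Ioi_mem_atTop 0)] with x hx0
      exact div_nonneg (cnt_nonneg _ _ _) (le_trans (mul_nonneg hc.le (le_of_lt hx0)) (hmass x hx0))
    · filter_upwards [mem_inf_of_left (Ioi_mem_atTop 0)] with x hx0
      have hM : 0 < R.mass h x := lt_of_lt_of_le (mul_pos hc hx0) (hmass x hx0)
      have hs : 0 < √x := Real.sqrt_pos.2 hx0
      rw [div_le_iff₀ hM]
      calc cnt N Set.univ √x ≤ K * √x := hKle _ hs
        _ = K / c / √x * (c * x) := by
          nth_rewrite 3 [← Real.sq_sqrt (le_of_lt hx0)]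
          field_simp
        _ ≤ _ := by
          gcongr
          exact hmass x hx0
  have h2 := h1.div (R.tendsto_cnt_div_mass hh) one_ne_zero
  rw [zero_div] at h2
  refine h2.congr' ?_
  filter_upwards [mem_inf_of_left (Ioi_mem_atTop 0)] with x hx0
  have hM : 0 < R.mass h x := lt_of_lt_of_le (mul_pos hc hx0) (hmass x hx0)
  simp only [Pi.div_apply]
  rw [div_div_div_cancel_right₀ hM.ne', R.card_hFreeBelow]

/-- For elements of norm between `√x` and `x`, the two normalizations hardly differ. -/
lemma add_mul_sqrt_bounds {u v a ε w : ℝ} (hu : 1 ≤ u) (huv : u ≤ v) (hvu : v ≤ u + 1)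
    (hε : |a| + 1 ≤ ε * √v) :
    ((w - u) / √u ≤ a → (w - v) / √v ≤ a + ε) ∧ ((w - v) / √v ≤ a - ε → (w - u) / √u ≤ a) := by
  have hu0 : 0 < √u := Real.sqrt_pos.2 (by linarith)
  have hv0 : 0 < √v := Real.sqrt_pos.2 (by linarith)
  have h1 : √u ≤ √v := Real.sqrt_le_sqrt huv
  have h2 : √v ≤ √u + 1 := by
    rw [Real.sqrt_le_left (by positivity)]
    nlinarith [Real.sq_sqrt (zero_le_one.trans hu)]
  -- In the allowance `|a| + 1`, the part `|a|` pays for the change of scale `a(√v - √u)` and the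
  -- part 1 for the change of center `v - u`.
  have h3 : |a * (√v - √u)| ≤ |a| := by
    rw [abs_mul, abs_of_nonneg (sub_nonneg.2 h1)]
    exact mul_le_of_le_one_right (abs_nonneg a) (by linarith)
  obtain ⟨h4, h5⟩ := abs_le.1 h3
  constructor
  · intro h
    rw [div_le_iff₀ hu0] at h
    rw [div_le_iff₀ hv0]
    nlinarith
  · intro h
    rw [div_le_iff₀ hv0] at h
    rw [div_le_iff₀ hu0]
    nlinarith

open Classical in
/-- Central limit theorem for `ω₁`, normalized by the norm. -/
lemma Regular.tendsto_card_filter_norm [Countable P] (R : Regular N Y κ θ C q) {h : ℕ} (hh : 2 ≤ h)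
    (a : ℝ) :
    Tendsto (fun x => (((R.hFreeBelow h x).filter fun m => 3 ≤ norm N m ∧
      (omegaOne m - lam (norm N m)) / √(lam (norm N m)) ≤ a).card : ℝ) / (R.hFreeBelow h x).card)
      (atTop ⊓ 𝓟 Y) (𝓝 (gaussPhi a)) := by
  have hsmall := R.tendsto_small hh (h := h)
  rw [Metric.tendsto_nhds]
  intro δ hδ
  -- The three thirds of `δ` go to the continuity of the limit, the convergence at `a ± ε/2`, and
  -- the elements of norm at most `√x`.
  obtain ⟨ε, hε, hcont⟩ := Metric.continuous_iff.1 continuous_gaussPhi a (δ / 3) (by positivity)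
  have hup := (R.tendsto_card_filter_lam hh (a + ε / 2)).eventually
    (Metric.ball_mem_nhds _ (show 0 < δ / 3 by positivity))
  have hlow := (R.tendsto_card_filter_lam hh (a - ε / 2)).eventually
    (Metric.ball_mem_nhds _ (show 0 < δ / 3 by positivity))
  have hsm := hsmall.eventually (Metric.ball_mem_nhds _ (show 0 < δ / 3 by positivity))
  have hlam : ∀ᶠ x in atTop, (|a| + 1) / (ε / 2) ≤ √(lam x) :=
    (Real.tendsto_sqrt_atTop.comp tendsto_lam).eventually_ge_atTop _
  filter_upwards [hup, hlow, hsm, mem_inf_of_left hlam,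
    mem_inf_of_left (tendsto_lam.eventually_ge_atTop 2),
    mem_inf_of_left (eventually_ge_atTop 9),
    mem_inf_of_left (Real.tendsto_log_atTop.eventually_ge_atTop 1)] with x x1 x2 x3 x4 x5 x6 x7
  have hc : 0 < ((R.hFreeBelow h x).card : ℝ) :=
    Nat.cast_pos.2 (Finset.card_pos.2 (R.hFreeBelow_nonempty (by linarith)))
  have hε2 : |a| + 1 ≤ ε / 2 * √(lam x) := by
    rw [div_le_iff₀ (by positivity)] at x4
    linarith
  -- comparison on elements of large norm
  have hlarge : ∀ m ∈ R.hFreeBelow h x, √x < norm N m →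
      3 ≤ norm N m ∧ 1 ≤ lam (norm N m) ∧ lam (norm N m) ≤ lam x ∧ lam x ≤ lam (norm N m) + 1 := by
    intro m hm hmx
    have hm2 := (R.mem_hFreeBelow.1 hm).2
    have h3 : (3 : ℝ) ≤ √x := Real.le_sqrt_of_sq_le (by linarith)
    have hn0 : (0 : ℝ) < norm N m := by linarith
    have hlog : Real.log x / 2 ≤ Real.log (norm N m) := by
      rw [← Real.log_sqrt (by linarith)]
      exact Real.log_le_log (by linarith) hmx.le
    have hlogpos : 0 < Real.log (norm N m) := by linarith
    have hle : lam (norm N m) ≤ lam x := Real.log_le_log hlogpos (Real.log_le_log hn0 hm2)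
    -- Passing from `x` to its square root lowers the iterated logarithm by `log 2 < 1`.
    have hge : lam x ≤ lam (norm N m) + 1 := by
      have h4 : Real.log (Real.log x / 2) ≤ lam (norm N m) := Real.log_le_log (by linarith) hlog
      rw [Real.log_div (by linarith) two_ne_zero] at h4
      have := Real.log_two_lt_d9
      simp only [lam] at h4 ⊢
      linarith
    refine ⟨?_, by linarith, hle, hge⟩
    exact_mod_cast (h3.trans hmx.le)
  set bad := (R.hFreeBelow h x).filter fun m => (norm N m : ℝ) ≤ √x
  have hbad : (bad.card : ℝ) ≤ cnt N Set.univ √x := by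
    rw [cnt, Nat.cast_le, ← Set.ncard_coe_finset]
    refine Set.ncard_le_ncard (fun m hm => ⟨trivial, ?_⟩) (R.finite _)
    exact (Finset.mem_filter.1 hm).2
  have b1 : (((R.hFreeBelow h x).filter fun m => 3 ≤ norm N m ∧
      (omegaOne m - lam (norm N m)) / √(lam (norm N m)) ≤ a).card : ℝ)
      ≤ ((R.hFreeBelow h x).filter fun m => (omegaOne m - lam x) / √(lam x) ≤ a + ε / 2).card
        + bad.card := by
    rw [← Nat.cast_add, Nat.cast_le]
    refine le_trans (Finset.card_le_card fun m hm => ?_) (Finset.card_union_le _ _)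
    obtain ⟨hm1, hm2, hm3⟩ := Finset.mem_filter.1 hm
    rw [Finset.mem_union, Finset.mem_filter, Finset.mem_filter]
    rcases le_or_gt (norm N m : ℝ) √x with hs | hs
    · exact Or.inr ⟨hm1, hs⟩
    · obtain ⟨-, g1, g2, g3⟩ := hlarge m hm1 hs
      exact Or.inl ⟨hm1, (add_mul_sqrt_bounds g1 g2 g3 hε2).1 hm3⟩
  have b2 : (((R.hFreeBelow h x).filter fun m =>
        (omegaOne m - lam x) / √(lam x) ≤ a - ε / 2).card : ℝ)
      ≤ ((R.hFreeBelow h x).filter fun m => 3 ≤ norm N m ∧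
      (omegaOne m - lam (norm N m)) / √(lam (norm N m)) ≤ a).card + bad.card := by
    rw [← Nat.cast_add, Nat.cast_le]
    refine le_trans (Finset.card_le_card fun m hm => ?_) (Finset.card_union_le _ _)
    obtain ⟨hm1, hm3⟩ := Finset.mem_filter.1 hm
    rw [Finset.mem_union, Finset.mem_filter, Finset.mem_filter]
    rcases le_or_gt (norm N m : ℝ) √x with hs | hs
    · exact Or.inr ⟨hm1, hs⟩
    · obtain ⟨g0, g1, g2, g3⟩ := hlarge m hm1 hs
      exact Or.inl ⟨hm1, g0, (add_mul_sqrt_bounds g1 g2 g3 hε2).2 hm3⟩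
  have c1 := hcont (a + ε / 2) (by rw [Real.dist_eq, add_sub_cancel_left, abs_of_pos] <;> linarith)
  have c2 := hcont (a - ε / 2) (by
    rw [Real.dist_eq, sub_sub_cancel_left, abs_neg, abs_of_pos] <;> linarith)
  have d1 := div_le_div_of_nonneg_right (b1.trans (add_le_add le_rfl hbad)) hc.le
  have d2 := div_le_div_of_nonneg_right (b2.trans (add_le_add le_rfl hbad)) hc.le
  rw [add_div] at d1 d2
  rw [Real.dist_eq, abs_lt] at x1 x2 x3
  rw [Real.dist_eq, abs_lt] at c1 c2
  rw [Real.dist_eq, abs_lt]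
  constructor <;> linarith [x1.1, x1.2, x2.1, x2.2, x3.1, x3.2, c1.1, c1.2, c2.1, c2.2]

end AbelianMonoid

/-! ### From the asymptotic counting hypothesis to explicit constants. -/

namespace AbelianMonoid

variable {P : Type*} {N : P → ℕ}

lemma IsNormRange.one_mem {X : Set ℚ} (hX : IsNormRange N X) : (1 : ℚ) ∈ X := by
  simpa [norm_zero] using hX.norm_mem 0

lemma IsNormRange.pow_mem {X : Set ℚ} (hX : IsNormRange N X) {x : ℚ} (hx : x ∈ X) (hx0 : x ≠ 0)
    (k : ℕ) : x ^ k ∈ X := by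
  induction k with
  | zero => simpa using hX.one_mem
  | succ k ih =>
    -- Closure under multiplication comes from dividing by a reciprocal.
    have := hX.div_mem _ ih _ (hX.div_mem _ hX.one_mem _ hx hx0) (one_div_ne_zero hx0)
    rwa [div_div_eq_mul_div, div_one, ← pow_succ] at this

/-- The bound `O(x^θ)` is only asymptotic. Between 1 and its threshold both the count and `κ x` are
bounded, and the constant absorbs them. Below 1 the count vanishes and `x ≤ x^θ` for an exponent
below 1. Any element of `X` that is at least 2 serves as `q`; one exists because `X` is unbounded.
-/
lemma SatisfiesStar.exists_regular (hN : ∀ p, 1 < N p) {X : Set ℚ} (hX : IsNormRange N X)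
    (hstar : SatisfiesStar N X) (hne : (toInftyIn X).NeBot) :
    ∃ κ θ C q, Regular N (Rat.cast '' X : Set ℝ) κ θ C q := by
  obtain ⟨hfin, κ, θ, hκ, hθ0, hθ1, hO⟩ := hstar
  have hXmem : ∀ᶠ x in toInftyIn X, x ∈ X := mem_inf_of_right (mem_principal_self X)
  have hge : ∀ y : ℚ, ∀ᶠ x in toInftyIn X, y ≤ x := fun y => mem_inf_of_left (eventually_ge_atTop y)
  have hfinite : ∀ y : ℝ, (below N Set.univ y).Finite := by
    intro y
    obtain ⟨n, hn⟩ := exists_nat_ge y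
    obtain ⟨x, hx, hxn⟩ := (hfin.and (hge n)).exists
    rw [upTo_eq_below] at hx
    refine hx.subset (below_mono le_rfl (hn.trans ?_))
    exact_mod_cast hxn
  obtain ⟨q, hqX, hq⟩ := (hXmem.and (hge 2)).exists
  have hq2 : (2 : ℝ) ≤ q := by exact_mod_cast hq
  obtain ⟨c, hc⟩ := hO.bound
  obtain ⟨x₀, hx₀⟩ := eventually_atTop.1 (eventually_inf_principal.1 hc)
  set y : ℝ := max x₀ 1
  set A := cnt N Set.univ y
  have hA : 0 ≤ A := cnt_nonneg _ _ _
  have hy1 : 1 ≤ y := le_max_right _ _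
  have hκy : κ ≤ κ * y := le_mul_of_one_le_right hκ.le hy1
  have hC : 0 ≤ |c| + A + κ * y := by positivity
  refine ⟨κ, max θ (3 / 4), |c| + A + κ * y, q, hN, hfinite, ?_, hκ, le_max_right _ _,
    max_lt hθ1 (by norm_num), hC, ?_, by linarith, fun k => ?_⟩
  · rintro _ ⟨x, hx, rfl⟩ m
    refine ⟨x / norm N m, hX.div_mem x hx _ (hX.norm_mem m) ?_, by push_cast; rfl⟩
    exact_mod_cast (norm_pos hN m).ne'
  · rintro _ ⟨x, hx, rfl⟩ hx0
    have hθ' : 0 ≤ (x : ℝ) ^ max θ (3 / 4) := Real.rpow_nonneg hx0.le _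
    rcases lt_or_ge (x : ℝ) 1 with h1 | h1
    · have hempty : below N Set.univ (x : ℝ) = ∅ := by
        ext m
        simp only [below, Set.mem_ofPred_eq, Set.mem_empty_iff_false, iff_false, not_and, not_le]
        exact fun _ => h1.trans_le (one_le_norm hN m)
      have hle : (x : ℝ) ≤ (x : ℝ) ^ max θ (3 / 4) := by
        simpa using Real.rpow_le_rpow_of_exponent_ge hx0 h1.le
          (max_lt hθ1 (by norm_num : (3 / 4 : ℝ) < 1)).le
      rw [cnt, hempty, Set.ncard_empty, Nat.cast_zero, zero_sub, abs_neg,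
        abs_of_nonneg (by positivity)]
      calc κ * (x : ℝ) ≤ κ * (x : ℝ) ^ max θ (3 / 4) := by gcongr
        _ ≤ _ := by
          gcongr
          linarith [abs_nonneg c]
    · have h1' : 1 ≤ (x : ℝ) ^ max θ (3 / 4) :=
        Real.one_le_rpow h1 ((by norm_num : (0 : ℝ) ≤ 3 / 4).trans (le_max_right _ _))
      rcases le_or_gt x₀ x with h2 | h2
      · have h := hx₀ x h2 hx
        rw [upTo_eq_below, Real.norm_eq_abs, Real.norm_of_nonneg (Real.rpow_nonneg hx0.le _)] at h
        refine h.trans ?_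
        have h3 : (x : ℝ) ^ θ ≤ (x : ℝ) ^ max θ (3 / 4) :=
          Real.rpow_le_rpow_of_exponent_le h1 (le_max_left _ _)
        have h4 : 0 ≤ (x : ℝ) ^ θ := Real.rpow_nonneg hx0.le _
        have h5 : c ≤ |c| + A + κ * y := by linarith [le_abs_self c]
        calc c * (x : ℝ) ^ θ ≤ (|c| + A + κ * y) * (x : ℝ) ^ θ := by gcongr
          _ ≤ _ := by gcongr
      · have hxy : (x : ℝ) ≤ y := le_max_of_le_left (by exact_mod_cast h2.le)
        have hcnt : cnt N Set.univ (x : ℝ) ≤ A :=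
          Nat.cast_le.2 (Set.ncard_le_ncard (below_mono le_rfl hxy) (hfinite y))
        have hcnt0 := cnt_nonneg N Set.univ (x : ℝ)
        have hκx : κ * x ≤ κ * y := by gcongr
        have hκx0 : 0 < κ * x := by positivity
        have h6 : |cnt N Set.univ (x : ℝ) - κ * x| ≤ |c| + A + κ * y := by
          rw [abs_le]
          constructor <;> linarith [abs_nonneg c]
        exact h6.trans (le_mul_of_one_le_right hC h1')
  · exact ⟨q ^ k, hX.pow_mem hqX (by linarith) k, by push_cast; rfl⟩

lemma tendsto_cast_toInftyIn (X : Set ℚ) :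
    Tendsto (Rat.cast : ℚ → ℝ) (toInftyIn X) (atTop ⊓ 𝓟 (Rat.cast '' X)) := by
  refine Tendsto.inf ?_ (tendsto_principal_principal.2 fun x hx => ⟨x, hx, rfl⟩)
  exact tendsto_ratCast_atTop_iff.2 tendsto_id

end AbelianMonoid

theorem theorem1p5 {P : Type*} [Countable P] (N : P → ℕ) (hN : ∀ p, 1 < N p)
    (X : Set ℚ) (hX : AbelianMonoid.IsNormRange N X) (hstar : AbelianMonoid.SatisfiesStar N X)
    (h : ℕ) (hh : 2 ≤ h) (a : ℝ) :
    Tendsto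
      (fun x : ℚ =>
        1 / ((AbelianMonoid.upTo N (AbelianMonoid.hFree P h) x).ncard : ℝ) *
          (({m | m ∈ AbelianMonoid.upTo N (AbelianMonoid.hFree P h) x ∧
              3 ≤ AbelianMonoid.norm N m ∧
              ((AbelianMonoid.omegaOne m : ℝ)
                  - Real.log (Real.log (AbelianMonoid.norm N m : ℝ)))
                / Real.sqrt (Real.log (Real.log (AbelianMonoid.norm N m : ℝ))) ≤ a}.ncard : ℕ) : ℝ))
      (AbelianMonoid.toInftyIn X) (𝓝 (AbelianMonoid.gaussPhi a)) := by
  classical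
  -- If `X` is bounded above, which forces `P` to be empty, the limit is vacuous.
  rcases eq_or_neBot (AbelianMonoid.toInftyIn X) with hbot | hne
  · rw [hbot]
    exact tendsto_bot
  obtain ⟨κ, θ, C, q, R⟩ := AbelianMonoid.SatisfiesStar.exists_regular hN hX hstar hne
  refine ((R.tendsto_card_filter_norm hh a).comp
    (AbelianMonoid.tendsto_cast_toInftyIn X)).congr fun x => ?_
  simp only [Function.comp]
  rw [R.card_hFreeBelow, AbelianMonoid.cnt, ← AbelianMonoid.upTo_eq_below, div_eq_inv_mul, one_div,
    ← Set.ncard_coe_finset]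
  congr 3
  ext m
  rw [Finset.mem_coe, Finset.mem_filter, R.mem_hFreeBelow]
  simp only [Set.mem_ofPred_eq, AbelianMonoid.upTo_eq_below, AbelianMonoid.below,
    AbelianMonoid.lam]
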